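/- Let $G$ be a compact Lie group acting smoothly and by isometries on a closed (compact, boundaryless, possibly disconnected) smooth Riemannian manifold $M$, and let $E\to M$ be a Hermitian vector bundle (continuity of the bundle and of its metric suffices) with a continuous action of $G$ covering the action on $M$ and acting by complex linear isometries between the fibres. Let $\alpha$ be an irreducible unitary representation of $G$, let $L^2(M,E)$ be the Hilbert space of square-integrable sections for the Riemannian measure, with $G$ acting by $(gs)(x)=g\,s(g^{-1}x)$, and let $\mathcal H_\alpha=L^2(M,E)_\alpha$ be its $\alpha$-isotypical component (the closed span of the images of all bounded $G$-equivariant maps $\alpha\to L^2(M,E)$). For a $G$-invariant open set $W\subset M$ define $L^2(W,E)_\alpha$ in the same way, with $L^2(W,E)\subset L^2(M,E)$ the sections vanishing almost everywhere outside $W$. Let $(T^*_GM)_x$ be the space of covectors at $x$ that vanish on all vectors $\frac{d}{dt}|_{t=0}e^{tY}x$, $Y\in\mathfrak g=\mathrm{Lie}(G)$, and put $$\mathcal P=\{x\in M : (T^*_GM)_x=\{0\}\},\qquad \mathcal N_\alpha=\{x\in M : \text{there is a tube } W_x \text{ around } x \text{ with } L^2(W_x,E)_\alpha=\{0\}\}.$$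 Here a tube around $x$ is an open set $W_x=G\,U_x$, where $U_x\ni x$ is a slice at $x$, i.e. $U_x$ is invariant under the isotropy group $G_x$ and $[g,y]\mapsto gy$ is a homeomorphism of $G\times_{G_x}U_x$ onto the open set $W_x$. (Both $\mathcal P$ and $\mathcal N_\alpha$ are $G$-invariant, open and closed.) For $f\in\mathcal C(M\smallsetminus(\mathcal P\cup\mathcal N_\alpha))^G$, a bounded $G$-invariant continuous function extended by zero to $M$ (continuous functions on this compact set are automatically bounded), multiplication by $f$ restricts to a bounded operator $M_f$ on $\mathcal H_\alpha$, and $f\mapsto M_f$ is a homomorphism of (not necessarily unital) $*$-algebras. Moreover, $M_f$ is compact on $\mathcal H_\alpha$ if and only if $f=0$. Hence $f\mapsto M_f$ induces an injective homomorphism from $\mathcal C(M\smallsetminus(\mathcal P\cup\mathcal N_\alpha))^G\cong\mathcal C\big((M\smallsetminus(\mathcal P\cup\mathcal N_\alpha))/G\big)$ to the Calkin algebra $\mathcal L(\mathcal H_\alpha)/\mathcal K(\mathcal H_\alpha)$. -/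

import Mathlib

open MeasureTheory Set Bundle
open scoped Manifold ContDiff ENNReal Topology BoundedContinuousFunction

noncomputable section

namespace EquivL2

set_option linter.unusedSectionVars false

/-! ### Hermitian vector bundles and their square-integrable sections -/

section L2

variable {M : Type*} (F : Type*) (V : M → Type*)

/-- The inner products on the fibres of a complex vector bundle form a continuous Hermitian metric:
the fibre norm is continuous on the total space (by polarization, so is the inner product). -/
class IsHermitianBundle [∀ x, NormedAddCommGroup (V x)] [TopologicalSpace (TotalSpace F V)] :
    Prop where
  continuous_norm : Continuous fun p : TotalSpace F V => ‖p.2‖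

variable [TopologicalSpace M] [MeasurableSpace M]
  [NormedAddCommGroup F] [NormedSpace ℂ F]
  [∀ x, NormedAddCommGroup (V x)] [∀ x, InnerProductSpace ℂ (V x)]
  [TopologicalSpace (TotalSpace F V)] [FiberBundle F V] [VectorBundle ℂ F V]

/-- A section is almost everywhere measurable if it is so in the distinguished local
trivializations. -/
def AEMeasurableSection (μ : Measure M) (s : ∀ x, V x) : Prop :=
  ∀ x₀ : M, AEStronglyMeasurable (fun x => (trivializationAt F V x₀ ⟨x, s x⟩).2)
    (μ.restrict (trivializationAt F V x₀).baseSet)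

variable {F V} {μ : Measure M} [BorelSpace M]

theorem AEMeasurableSection.add {s t : ∀ x, V x} (hs : AEMeasurableSection F V μ s)
    (ht : AEMeasurableSection F V μ t) : AEMeasurableSection F V μ (s + t) := by
  intro x₀
  refine ((hs x₀).add (ht x₀)).congr ?_
  filter_upwards [ae_restrict_mem (trivializationAt F V x₀).open_baseSet.measurableSet] with x hx
  exact (((trivializationAt F V x₀).linear ℂ hx).map_add (s x) (t x)).symm

theorem AEMeasurableSection.smul {s : ∀ x, V x} (c : ℂ)
    (hs : AEMeasurableSection F V μ s) : AEMeasurableSection F V μ (c • s) := by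
  intro x₀
  refine ((hs x₀).const_smul c).congr ?_
  filter_upwards [ae_restrict_mem (trivializationAt F V x₀).open_baseSet.measurableSet] with x hx
  exact (((trivializationAt F V x₀).linear ℂ hx).map_smul c (s x)).symm

theorem AEMeasurableSection.zero : AEMeasurableSection F V μ (0 : ∀ x, V x) := by
  intro x₀
  refine (aestronglyMeasurable_const (b := (0 : F))).congr ?_
  filter_upwards [ae_restrict_mem (trivializationAt F V x₀).open_baseSet.measurableSet] with x hx
  exact (((trivializationAt F V x₀).linear ℂ hx).map_zero).symm

variable [CompactSpace M] [FiniteDimensional ℂ F] [IsHermitianBundle F V]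

theorem AEMeasurableSection.norm {s : ∀ x, V x}
    (hs : AEMeasurableSection F V μ s) : AEStronglyMeasurable (fun x => ‖s x‖) μ := by
  classical
  have key : ∀ x₀ : M, AEMeasurable (fun x => ‖s x‖)
      (μ.restrict (trivializationAt F V x₀).baseSet) := by
    intro x₀
    let _ : MeasurableSpace F := borel F
    have : BorelSpace F := ⟨rfl⟩
    have : ProperSpace F := FiniteDimensional.proper ℂ F
    set e := trivializationAt F V x₀ with he
    let U : Set M := e.baseSet
    let h : M × F → ℝ := fun q => ‖(e.toOpenPartialHomeomorph.symm q).2‖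
    have hU : MeasurableSet (U ×ˢ (univ : Set F)) :=
      e.open_baseSet.measurableSet.prod MeasurableSet.univ
    have hc : ContinuousOn h (U ×ˢ univ) := by
      have h1 := e.toOpenPartialHomeomorph.continuousOn_symm
      rw [e.target_eq] at h1
      exact (IsHermitianBundle.continuous_norm (F := F) (V := V)).comp_continuousOn h1
    have hm : Measurable ((U ×ˢ (univ : Set F)).piecewise h (fun _ => 0)) :=
      hc.measurable_piecewise continuousOn_const hU
    have hw : AEMeasurable (fun x => (x, (e ⟨x, s x⟩).2)) (μ.restrict U) :=
      aemeasurable_id.prodMk (hs x₀).aemeasurable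
    refine (hm.comp_aemeasurable hw).congr ?_
    filter_upwards [ae_restrict_mem e.open_baseSet.measurableSet] with x hx
    have hmem : (⟨x, s x⟩ : TotalSpace F V) ∈ e.source := e.mem_source.2 hx
    have h2 : (x, (e ⟨x, s x⟩).2) = e ⟨x, s x⟩ := by
      ext1
      · exact (e.coe_fst hmem).symm
      · rfl
    have h3 : (x, (e ⟨x, s x⟩).2) ∈ U ×ˢ (univ : Set F) := ⟨hx, mem_univ _⟩
    have h4 : e.toOpenPartialHomeomorph.symm (e ⟨x, s x⟩) = ⟨x, s x⟩ :=
      e.toOpenPartialHomeomorph.left_inv hmem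
    simp only [Function.comp, piecewise_eq_of_mem _ _ _ h3, h]
    rw [h2, h4]
  obtain ⟨T, hT⟩ := isCompact_univ.elim_finite_subcover
    (fun x₀ : M => (trivializationAt F V x₀).baseSet)
    (fun x₀ => (trivializationAt F V x₀).open_baseSet)
    (fun x _ => mem_iUnion.2 ⟨x, FiberBundle.mem_baseSet_trivializationAt' x⟩)
  have := (aemeasurable_iUnion_iff (μ := μ) (f := fun x => ‖s x‖)
    (s := fun i : T => (trivializationAt F V (i : M)).baseSet)).2 fun i => key i
  rw [show (⋃ i : T, (trivializationAt F V (i : M)).baseSet) = univ from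
    univ_subset_iff.1 (by simpa [iUnion_subtype] using hT), Measure.restrict_univ] at this
  exact this.aestronglyMeasurable

theorem memLp_norm_add {s t : ∀ x, V x}
    (hs : AEMeasurableSection F V μ s) (ht : AEMeasurableSection F V μ t)
    (hs' : MemLp (fun x => ‖s x‖) 2 μ) (ht' : MemLp (fun x => ‖t x‖) 2 μ) :
    MemLp (fun x => ‖(s + t) x‖) 2 μ :=
  (hs'.add ht').mono' (hs.add ht).norm
    (Filter.Eventually.of_forall fun x => by simpa using norm_add_le (s x) (t x))

variable (F V μ)

/-- The space of square-integrable sections (before identifying sections that agree almost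
everywhere). -/
def squareIntegrable : Submodule ℂ (∀ x, V x) where
  carrier := {s | AEMeasurableSection F V μ s ∧ MemLp (fun x => ‖s x‖) 2 μ}
  add_mem' := fun hs ht => ⟨hs.1.add ht.1, memLp_norm_add hs.1 ht.1 hs.2 ht.2⟩
  zero_mem' := ⟨.zero, by simp⟩
  smul_mem' := fun c s hs => ⟨hs.1.smul c, by
    simpa [norm_smul] using hs.2.const_mul ‖c‖⟩

/-- Square-integrable sections as a type, to be given the `L²` seminorm. -/
def SqIntSection : Type _ := squareIntegrable F V μ

instance : AddCommGroup (SqIntSection F V μ) :=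
  inferInstanceAs (AddCommGroup (squareIntegrable F V μ))

instance : Module ℂ (SqIntSection F V μ) :=
  inferInstanceAs (Module ℂ (squareIntegrable F V μ))

variable {F V μ}

/-- The underlying section. -/
def SqIntSection.toFun (s : SqIntSection F V μ) : ∀ x, V x := s.1

theorem SqIntSection.toFun_mem (s : SqIntSection F V μ) : s.toFun ∈ squareIntegrable F V μ := s.2

theorem SqIntSection.toFun_add (s t : SqIntSection F V μ) (x : M) :
    (s + t).toFun x = s.toFun x + t.toFun x := rfl

theorem SqIntSection.toFun_sub (s t : SqIntSection F V μ) (x : M) :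
    (s - t).toFun x = s.toFun x - t.toFun x := rfl

theorem SqIntSection.toFun_smul (c : ℂ) (s : SqIntSection F V μ) (x : M) :
    (c • s).toFun x = c • s.toFun x := rfl

theorem integrable_inner (s t : SqIntSection F V μ) :
    Integrable (fun x => inner ℂ (s.toFun x) (t.toFun x)) μ := by
  have hm : AEStronglyMeasurable (fun x => inner ℂ (s.toFun x) (t.toFun x)) μ := by
    have h : ∀ c : ℂ, AEStronglyMeasurable (fun x => ((‖s.toFun x + c • t.toFun x‖ : ℝ) : ℂ)) μ :=
      fun c => Complex.continuous_ofReal.comp_aestronglyMeasurable (s.toFun_mem.1.add (t.toFun_mem.1.smul c)).norm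
    have h' := ((((h 1).pow 2).sub ((h (-1)).pow 2)).add
      ((((h (-Complex.I)).pow 2).sub ((h Complex.I).pow 2)).mul_const Complex.I)).mul_const
        (4 : ℂ)⁻¹
    refine h'.congr (Filter.Eventually.of_forall fun x => ?_)
    have h4 := inner_eq_sum_norm_sq_div_four (𝕜 := ℂ) (s.toFun x) (t.toFun x)
    simp only [h4]
    simp [div_eq_mul_inv, sub_eq_add_neg]
  refine (s.toFun_mem.2.integrable_mul t.toFun_mem.2).mono' hm (Filter.Eventually.of_forall fun x => ?_)
  exact norm_inner_le_norm _ _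

/-- The sesquilinear form `⟪s, t⟫ = ∫ ⟪s x, t x⟫ dμ`. -/
instance sqIntCore : PreInnerProductSpace.Core ℂ (SqIntSection F V μ) where
  inner s t := ∫ x, inner ℂ (s.toFun x) (t.toFun x) ∂μ
  conj_inner_symm s t := by
    rw [← integral_conj]
    simp
  re_inner_nonneg s := by
    have h : ∀ x, inner ℂ (s.toFun x) (s.toFun x) = ((‖s.toFun x‖ ^ 2 : ℝ) : ℂ) := fun x => by
      rw [inner_self_eq_norm_sq_to_K]; simp
    simp only [h]
    rw [integral_complex_ofReal]
    exact integral_nonneg fun x => by positivity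
  add_left r s t := by
    rw [← integral_add (integrable_inner r t) (integrable_inner s t)]
    exact integral_congr_ae (Filter.Eventually.of_forall fun x => inner_add_left _ _ _)
  smul_left s t c := by
    rw [← integral_const_mul]
    exact integral_congr_ae (Filter.Eventually.of_forall fun x => inner_smul_left _ _ _)

instance : SeminormedAddCommGroup (SqIntSection F V μ) :=
  InnerProductSpace.Core.toSeminormedAddCommGroup (𝕜 := ℂ)

instance : InnerProductSpace ℂ (SqIntSection F V μ) :=
  InnerProductSpace.ofCore sqIntCore

variable (F V μ)

/-- The Hilbert space `L²(M, V)`: square-integrable sections modulo the kernel of the seminorm,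
that is, modulo equality almost everywhere. -/
abbrev L2 : Type _ := SeparationQuotient (SqIntSection F V μ)

variable {F V μ}

/-- A section representing an element of `L²(M, V)`; it is unique up to almost everywhere
equality. -/
def L2.rep (u : L2 F V μ) (x : M) : V x :=
  (Function.surjInv SeparationQuotient.surjective_mk u : SqIntSection F V μ).toFun x

theorem L2.mk_eq_mk_iff (s t : SqIntSection F V μ) :
    (SeparationQuotient.mk s : L2 F V μ) = SeparationQuotient.mk t ↔
      ∀ᵐ x ∂μ, s.toFun x = t.toFun x := by
  have h1 : inner ℂ (s - t) (s - t) = ((∫ x, ‖s.toFun x - t.toFun x‖ ^ 2 ∂μ : ℝ) : ℂ) := by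
    rw [← integral_complex_ofReal]
    change ∫ x, inner ℂ ((s - t).toFun x) ((s - t).toFun x) ∂μ = _
    refine integral_congr_ae (Filter.Eventually.of_forall fun x => ?_)
    simp only [SqIntSection.toFun_sub]
    rw [inner_self_eq_norm_sq_to_K]; simp
  have h2 : Integrable (fun x => ‖s.toFun x - t.toFun x‖ ^ 2) μ := (s - t).toFun_mem.2.integrable_sq
  rw [SeparationQuotient.mk_eq_mk, Metric.inseparable_iff, dist_eq_norm, ← sq_eq_zero_iff,
    @norm_sq_eq_re_inner ℂ, h1]
  rw [show RCLike.re ((∫ x, ‖s.toFun x - t.toFun x‖ ^ 2 ∂μ : ℝ) : ℂ) =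
    ∫ x, ‖s.toFun x - t.toFun x‖ ^ 2 ∂μ from Complex.ofReal_re _]
  rw [integral_eq_zero_iff_of_nonneg (fun x => by positivity) h2]
  refine Filter.eventually_congr (Filter.Eventually.of_forall fun x => ?_)
  simp [sub_eq_zero]

theorem L2.rep_mk (s : SqIntSection F V μ) :
    ∀ᵐ x ∂μ, L2.rep (SeparationQuotient.mk s : L2 F V μ) x = s.toFun x :=
  (L2.mk_eq_mk_iff _ s).1 (Function.surjInv_eq SeparationQuotient.surjective_mk _)

end L2

/-! ### Equivariant bundles and isotypical components -/

section Equivariant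

variable (G : Type*) [Group G] [TopologicalSpace G] {M : Type*} [MulAction G M]

/-- A continuous action of `G` on the total space of the bundle `V` that covers the action of `G`
on the base and maps the fibre over `x` to the fibre over `g • x` by a complex linear isometry. -/
structure BundleAction [TopologicalSpace M] (F : Type*) (V : M → Type*)
    [∀ x, NormedAddCommGroup (V x)] [∀ x, InnerProductSpace ℂ (V x)]
    [TopologicalSpace (TotalSpace F V)] where
  act : ∀ (g : G) (x : M), V x →ₗᵢ[ℂ] V (g • x)
  one_act : ∀ (x : M) (v : V x),
    (⟨(1 : G) • x, act 1 x v⟩ : TotalSpace F V) = ⟨x, v⟩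
  mul_act : ∀ (g h : G) (x : M) (v : V x),
    (⟨(g * h) • x, act (g * h) x v⟩ : TotalSpace F V) =
      ⟨g • h • x, act g (h • x) (act h x v)⟩
  continuous_act : Continuous fun q : G × TotalSpace F V =>
    (⟨q.1 • q.2.1, act q.1 q.2.1 q.2.2⟩ : TotalSpace F V)

variable {G}

/-- A (strongly continuous) unitary representation on a Hilbert space that is irreducible: the
space is nonzero and its only closed invariant subspaces are the trivial ones. -/
structure IsIrreducibleUnitary {A : Type*} [NormedAddCommGroup A] [InnerProductSpace ℂ A]
    (α : Representation ℂ G A) : Prop where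
  continuous : Continuous fun p : G × A => α p.1 p.2
  norm_map : ∀ (g : G) (a : A), ‖α g a‖ = ‖a‖
  nontrivial : Nontrivial A
  irreducible : ∀ N : Submodule ℂ A, IsClosed (N : Set A) →
    (∀ g : G, ∀ a ∈ N, α g a ∈ N) → N = ⊥ ∨ N = ⊤

variable [TopologicalSpace M] [CompactSpace M] [MeasurableSpace M] [BorelSpace M]
  {F : Type*} {V : M → Type*} [NormedAddCommGroup F] [NormedSpace ℂ F] [FiniteDimensional ℂ F]
  [∀ x, NormedAddCommGroup (V x)] [∀ x, InnerProductSpace ℂ (V x)]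
  [TopologicalSpace (TotalSpace F V)] [FiberBundle F V] [VectorBundle ℂ F V]
  [IsHermitianBundle F V] {μ : Measure M}
  {A : Type*} [NormedAddCommGroup A] [InnerProductSpace ℂ A]

/-- A bounded operator `T : A → L²(M, V)` is `G`-equivariant, where `G` acts on sections by
`(g s)(x) = g (s (g⁻¹ x))`, equivalently `(g s)(g y) = g (s y)`. -/
def IsIntertwiner (ρ : BundleAction G F V) (α : Representation ℂ G A) (T : A →L[ℂ] L2 F V μ) :
    Prop :=
  ∀ (g : G) (a : A), ∀ᵐ y ∂μ, (T (α g a)).rep (g • y) = ρ.act g y ((T a).rep y)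

/-- The `α`-isotypical component `L²(W, V)_α` for an invariant open set `W`, where `L²(W, V)` is the
subspace of `L²(M, V)` of the sections that vanish almost everywhere outside `W`: the closed linear
span of the ranges of all equivariant operators from `α` to `L²(W, V)`. -/
def isotypicalOn (μ : Measure M) (ρ : BundleAction G F V) (α : Representation ℂ G A) (W : Set M) :
    Submodule ℂ (L2 F V μ) :=
  (Submodule.span ℂ {u | ∃ T : A →L[ℂ] L2 F V μ, IsIntertwiner ρ α T ∧
    (∀ a, ∀ᵐ x ∂μ, x ∉ W → (T a).rep x = 0) ∧ u ∈ range T}).topologicalClosure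

/-- The `α`-isotypical component `ℋ_α = L²(M, V)_α`. -/
abbrev isotypical (μ : Measure M) (ρ : BundleAction G F V) (α : Representation ℂ G A) :
    Submodule ℂ (L2 F V μ) :=
  isotypicalOn μ ρ α univ

end Equivariant

/-! ### Slices and tubes, and the two exceptional sets -/

section Sets

variable (G : Type*) [Group G] [TopologicalSpace G] {M : Type*} [TopologicalSpace M]
  [MulAction G M]

/-- `S` is a slice at `x`: it contains `x`, is invariant under the isotropy group `G_x`, and
`[g, y] ↦ g y` is a homeomorphism of the twisted product `G ×_{G_x} S` onto an open set. The last
two fields say that this map is injective and open. -/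
structure IsSlice (x : M) (S : Set M) : Prop where
  mem : x ∈ S
  smul_mem : ∀ h ∈ MulAction.stabilizer G x, ∀ y ∈ S, h • y ∈ S
  mem_stabilizer : ∀ (g : G), ∀ y ∈ S, g • y ∈ S → g ∈ MulAction.stabilizer G x
  isOpenMap : IsOpenMap fun p : G × S => p.1 • (p.2 : M)

/-- `W` is a tube around `x`: `W = G S ≅ G ×_{G_x} S` for some slice `S` at `x`. -/
def IsTube (x : M) (W : Set M) : Prop :=
  ∃ S : Set M, IsSlice G x S ∧ W = {z | ∃ g : G, ∃ y ∈ S, z = g • y}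

variable {G}

/-- The set `𝒩_α` of the points that have a tube `W` with `L²(W, V)_α = 0`. -/
def nullSet [CompactSpace M] [MeasurableSpace M] [BorelSpace M]
    {F : Type*} {V : M → Type*} [NormedAddCommGroup F] [NormedSpace ℂ F] [FiniteDimensional ℂ F]
    [∀ x, NormedAddCommGroup (V x)] [∀ x, InnerProductSpace ℂ (V x)]
    [TopologicalSpace (TotalSpace F V)] [FiberBundle F V] [VectorBundle ℂ F V]
    [IsHermitianBundle F V] {A : Type*} [NormedAddCommGroup A] [InnerProductSpace ℂ A]
    (μ : Measure M) (ρ : BundleAction G F V) (α : Representation ℂ G A) : Set M :=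
  {x | ∃ W : Set M, IsTube G x W ∧ isotypicalOn μ ρ α W = ⊥}

variable (G)

/-- The fibre at `x` of the `G`-transverse cotangent space: the covectors at `x` that vanish on
`Y_M(x) = d/dt (exp(tY) x)` at `t = 0`, for all `Y` in the Lie algebra of `G`. The vector `Y_M(x)`
is the derivative at `1` of the orbit map `g ↦ g • x` in the direction `Y`. -/
def transverseCotangent (d n : ℕ) [ChartedSpace (EuclideanSpace ℝ (Fin d)) G]
    [ChartedSpace (EuclideanSpace ℝ (Fin n)) M] (x : M) :
    Set (TangentSpace (𝓡 n) x →L[ℝ] ℝ) :=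
  {ξ | ∀ Y : GroupLieAlgebra (𝓡 d) G, ξ (mfderiv (𝓡 d) (𝓡 n) (fun g : G => g • x) 1 Y) = 0}

/-- The set `𝒫` of the points where the `G`-transverse cotangent space is zero. -/
def discreteSlicePoints (d n : ℕ) [ChartedSpace (EuclideanSpace ℝ (Fin d)) G]
    (M : Type*) [TopologicalSpace M] [MulAction G M]
    [ChartedSpace (EuclideanSpace ℝ (Fin n)) M] : Set M :=
  {x | transverseCotangent G d n x = {0}}

/-- The algebra of `G`-invariant (bounded) continuous functions on `S`; when `S` is compact this
is `C(S)^G`, which is canonically `C(S/G)`. -/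
def invariantFunctions (S : Set M) : StarSubalgebra ℂ (S →ᵇ ℂ) where
  carrier := {f | ∀ (g : G) (x y : S), (y : M) = g • (x : M) → f y = f x}
  mul_mem' := fun ha hb g x y h => by simp [ha g x y h, hb g x y h]
  add_mem' := fun ha hb g x y h => by simp [ha g x y h, hb g x y h]
  algebraMap_mem' := fun c g x y h => rfl
  star_mem' := fun ha g x y h => by simp [ha g x y h]

/-- Extension by zero of a function on `S`. -/
def extendZero {M : Type*} {S : Set M} (f : S → ℂ) (x : M) : ℂ :=
  open Classical in if h : x ∈ S then f ⟨x, h⟩ else 0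

end Sets

/-! ### The Calkin algebra -/

section Calkin

variable (H : Type*) [NormedAddCommGroup H] [InnerProductSpace ℂ H]

/-- The ideal of compact operators in the algebra of bounded operators. -/
def compactIdeal : Ideal (H →L[ℂ] H) where
  carrier := {T | IsCompactOperator T}
  add_mem' := fun ha hb => ha.add hb
  zero_mem' := isCompactOperator_zero
  smul_mem' := fun c _ ha => ha.clm_comp c

instance : (compactIdeal H).IsTwoSided := ⟨fun {_} b ha => ha.comp_clm b⟩

/-- The Calkin algebra: bounded operators modulo compact operators. -/
abbrev Calkin : Type _ := (H →L[ℂ] H) ⧸ compactIdeal H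

end Calkin

end EquivL2

end

/-!
The multiplication operator `M_f` of an invariant function commutes with the action of `G`, so it
preserves the closed span of the images of the intertwiners; that `f ↦ M_f` is a `*`-homomorphism
is checked pointwise. What has to be proved is that `M_f` is not compact when `f x ≠ 0` for some
`x ∉ 𝒫 ∪ 𝒩_α`.

Suppose `f x ≠ 0`. On a small tube `W` around `x` one has `|f| ≥ ε > 0` outside `𝒩_α`, where all
isotypical sections vanish, so `M_f` is bounded below on `L²(W, V)_α`, and a compact operator is
bounded below only on finite-dimensional subspaces. The component `L²(W, V)_α` is however
infinite-dimensional: otherwise there would be a tube around `x` with a component of least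
dimension, all smaller tubes would have the same component, and its sections would vanish outside
the intersection of all invariant neighbourhoods of `x`, which is the orbit of `x`, a null set since
`x ∉ 𝒫`. So the component would be zero and `x ∈ 𝒩_α`. This is
`not_finiteDimensional_isotypicalOn` and `eq_zero_of_isCompactOperator_mulHom`.

Two geometric facts are used.

* Every point `x` has arbitrarily small slices (`hasSmallSlices`). In a chart at `x` one projects
  to the tangent space of the orbit and averages the projection over the isotropy group `H` with
  respect to Haar measure; the result is an `H`-equivariant map `ψ` whose derivative at `x` is the
  identity on this tangent space. The slice is the zero set of `ψ` in a small ball around `x`. By the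
  implicit function theorem, every point near `x` has a unique small displacement to the zero set
  by group elements transverse to `H`. That every group element which moves `x` little acts on `x`
  like one of these is the constant rank theorem for the orbit map of `x`, whose rank is constant
  by homogeneity.

* A point is in `𝒫` if and only if its orbit is a neighbourhood of it, and the orbits of the other
  points are null sets. If the derivative of the orbit map is onto, this is the open mapping theorem
  for strictly differentiable maps. If not, the orbit is by constant rank and compactness a finite
  union of Lipschitz images of pieces of a space of dimension less than `n`, hence has Hausdorff
  dimension less than `n` (`dimH_orbit_lt`). The description of `𝒫` by open orbits shows that it is
  invariant, and closed, as an orbit that is open and closed contains every connected set it meets.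
-/

noncomputable section

namespace EquivL2

set_option linter.unusedSectionVars false

/-! ### Multiplication operators on square-integrable sections -/

section Multiplication

variable {M : Type*} {F : Type*} {V : M → Type*} [TopologicalSpace M] [MeasurableSpace M]
  [NormedAddCommGroup F] [NormedSpace ℂ F]
  [∀ x, NormedAddCommGroup (V x)] [∀ x, InnerProductSpace ℂ (V x)]
  [TopologicalSpace (TotalSpace F V)] [FiberBundle F V] [VectorBundle ℂ F V]
  {μ : Measure M} [BorelSpace M] [CompactSpace M] [FiniteDimensional ℂ F] [IsHermitianBundle F V]

/-- A scalar function that is measurable and bounded, so that it multiplies `L²` to itself. -/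
def IsMultiplier (m : M → ℂ) : Prop := Measurable m ∧ ∃ C, ∀ x, ‖m x‖ ≤ C

theorem IsMultiplier.indicator {m : M → ℂ} (hm : IsMultiplier m) {W : Set M}
    (hW : MeasurableSet W) : IsMultiplier (W.indicator m) := by
  obtain ⟨h, C, hC⟩ := hm
  exact ⟨h.indicator hW, C, fun x => (norm_indicator_le_norm_self m x).trans (hC x)⟩

theorem isMultiplier_const (c : ℂ) : IsMultiplier fun _ : M => c :=
  ⟨measurable_const, ‖c‖, fun _ => le_rfl⟩

theorem squareIntegrable_mul {m : M → ℂ} (hm : IsMultiplier m) (s : SqIntSection F V μ) :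
    (fun x => m x • s.toFun x) ∈ squareIntegrable F V μ := by
  obtain ⟨hm, C, hC⟩ := hm
  have h : AEMeasurableSection F V μ (fun x => m x • s.toFun x) := by
    intro x₀
    refine (hm.aestronglyMeasurable.smul (s.toFun_mem.1 x₀)).congr ?_
    filter_upwards [ae_restrict_mem (trivializationAt F V x₀).open_baseSet.measurableSet] with x hx
    exact (((trivializationAt F V x₀).linear ℂ hx).map_smul (m x) (s.toFun x)).symm
  refine ⟨h, (s.toFun_mem.2.const_mul C).mono' h.norm (Filter.Eventually.of_forall fun x => ?_)⟩
  rw [norm_norm, norm_smul]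
  exact mul_le_mul_of_nonneg_right (hC x) (norm_nonneg (s.toFun x))

theorem SqIntSection.norm_sq (s : SqIntSection F V μ) : ‖s‖ ^ 2 = ∫ x, ‖s.toFun x‖ ^ 2 ∂μ := by
  rw [@norm_sq_eq_re_inner ℂ]
  have h1 : inner ℂ s s = ((∫ x, ‖s.toFun x‖ ^ 2 ∂μ : ℝ) : ℂ) := by
    rw [← integral_complex_ofReal]
    change ∫ x, inner ℂ (s.toFun x) (s.toFun x) ∂μ = _
    refine integral_congr_ae (Filter.Eventually.of_forall fun x => ?_)
    simp only
    rw [inner_self_eq_norm_sq_to_K]; simp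
  rw [h1]
  exact Complex.ofReal_re _

/-- Multiplication by a bounded measurable function, before passing to classes of sections. -/
def mulSection (m : M → ℂ) (hm : IsMultiplier m) :
    SqIntSection F V μ →L[ℂ] SqIntSection F V μ :=
  LinearMap.mkContinuousOfExistsBound
    { toFun := fun s => (⟨_, squareIntegrable_mul hm s⟩ : squareIntegrable F V μ)
      map_add' := fun s t => Subtype.ext (funext fun x => smul_add _ _ _)
      map_smul' := fun c s => Subtype.ext (funext fun x => smul_comm _ _ _) } <| by
    obtain ⟨-, C, hC⟩ := id hm
    refine ⟨|C|, fun s => abs_le_of_sq_le_sq' ?_ (by positivity) |>.2⟩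
    rw [mul_pow, SqIntSection.norm_sq, SqIntSection.norm_sq, ← integral_const_mul]
    refine integral_mono_of_nonneg (Filter.Eventually.of_forall fun x => by positivity)
      (s.toFun_mem.2.integrable_sq.const_mul _) (Filter.Eventually.of_forall fun x => ?_)
    change ‖m x • s.toFun x‖ ^ 2 ≤ _
    rw [norm_smul, mul_pow]
    exact mul_le_mul_of_nonneg_right
      (pow_le_pow_left₀ (norm_nonneg _) ((hC x).trans (le_abs_self C)) 2) (sq_nonneg _)

theorem mulSection_toFun {m : M → ℂ} (hm : IsMultiplier m) (s : SqIntSection F V μ) (x : M) :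
    (mulSection m hm s).toFun x = m x • s.toFun x := rfl

/-- Multiplication by a bounded measurable function as a bounded operator on `L²(M, V)`. -/
def mulOp (m : M → ℂ) (hm : IsMultiplier m) : L2 F V μ →L[ℂ] L2 F V μ :=
  SeparationQuotient.liftCLM ((SeparationQuotient.mkCLM ℂ _).comp (mulSection m hm))
    fun _ _ h => (SeparationQuotient.mk_eq_mk.2 (h.map (mulSection m hm).continuous))

namespace L2

theorem ext_iff_ae {u v : L2 F V μ} : u = v ↔ ∀ᵐ x ∂μ, u.rep x = v.rep x := by
  obtain ⟨s, rfl⟩ := SeparationQuotient.surjective_mk u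
  obtain ⟨t, rfl⟩ := SeparationQuotient.surjective_mk v
  rw [mk_eq_mk_iff]
  refine ⟨fun h => ?_, fun h => ?_⟩ <;>
  · filter_upwards [h, rep_mk s, rep_mk t] with x h1 h2 h3
    simp_all

theorem rep_zero : ∀ᵐ x ∂μ, (0 : L2 F V μ).rep x = 0 :=
  rep_mk (0 : SqIntSection F V μ)

theorem eq_zero_iff_ae {u : L2 F V μ} : u = 0 ↔ ∀ᵐ x ∂μ, u.rep x = 0 := by
  rw [ext_iff_ae]
  refine ⟨fun h => ?_, fun h => ?_⟩ <;>
  · filter_upwards [h, rep_zero (F := F) (V := V) (μ := μ)] with x h1 h2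
    simp_all

theorem rep_add (u v : L2 F V μ) : ∀ᵐ x ∂μ, (u + v).rep x = u.rep x + v.rep x := by
  obtain ⟨s, rfl⟩ := SeparationQuotient.surjective_mk u
  obtain ⟨t, rfl⟩ := SeparationQuotient.surjective_mk v
  filter_upwards [rep_mk s, rep_mk t, rep_mk (s + t)] with x h1 h2 h3
  rw [h1, h2, ← SqIntSection.toFun_add, ← h3]
  rfl

theorem rep_smul (c : ℂ) (u : L2 F V μ) : ∀ᵐ x ∂μ, (c • u).rep x = c • u.rep x := by
  obtain ⟨s, rfl⟩ := SeparationQuotient.surjective_mk u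
  filter_upwards [rep_mk s, rep_mk (c • s)] with x h1 h3
  rw [h1, ← SqIntSection.toFun_smul, ← h3]
  rfl

theorem rep_mulOp {m : M → ℂ} (hm : IsMultiplier m) (u : L2 F V μ) :
    ∀ᵐ x ∂μ, (mulOp m hm u).rep x = m x • u.rep x := by
  obtain ⟨s, rfl⟩ := SeparationQuotient.surjective_mk u
  filter_upwards [rep_mk s, rep_mk (mulSection m hm s)] with x h1 h2
  rw [h1, ← mulSection_toFun hm, ← h2]
  rfl

theorem inner_eq_integral (u v : L2 F V μ) :
    inner ℂ u v = ∫ x, inner ℂ (u.rep x) (v.rep x) ∂μ := by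
  obtain ⟨s, rfl⟩ := SeparationQuotient.surjective_mk u
  obtain ⟨t, rfl⟩ := SeparationQuotient.surjective_mk v
  rw [SeparationQuotient.inner_mk_mk]
  change ∫ x, inner ℂ (s.toFun x) (t.toFun x) ∂μ = _
  refine integral_congr_ae ?_
  filter_upwards [rep_mk s, rep_mk t] with x h1 h2
  rw [h1, h2]

end L2

theorem mulOp_eq_self_iff {m : M → ℂ} (hm : IsMultiplier m) (u : L2 F V μ) :
    mulOp m hm u = u ↔ ∀ᵐ x ∂μ, m x • u.rep x = u.rep x := by
  rw [L2.ext_iff_ae]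
  refine ⟨fun h => ?_, fun h => ?_⟩ <;>
  · filter_upwards [h, L2.rep_mulOp hm u] with x h1 h2
    simp_all

theorem inner_mulOp_left {m m' : M → ℂ} (hm : IsMultiplier m) (hm' : IsMultiplier m')
    (h : ∀ x, m' x = starRingEnd ℂ (m x)) (u v : L2 F V μ) :
    inner ℂ (mulOp m hm u) v = inner ℂ u (mulOp m' hm' v) := by
  rw [L2.inner_eq_integral, L2.inner_eq_integral]
  refine integral_congr_ae ?_
  filter_upwards [L2.rep_mulOp hm u, L2.rep_mulOp hm' v] with x h1 h2
  rw [h1, h2, inner_smul_left, inner_smul_right, h]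

/-- The sections that vanish almost everywhere outside a Borel set form a closed subspace. -/
theorem isClosed_setOf_rep_eq_zero {W : Set M} (hW : MeasurableSet W) :
    IsClosed {u : L2 F V μ | ∀ᵐ x ∂μ, x ∉ W → u.rep x = 0} := by
  have h1 := (isMultiplier_const (M := M) 1).indicator hW
  have : {u : L2 F V μ | ∀ᵐ x ∂μ, x ∉ W → u.rep x = 0} = {u | mulOp _ h1 u = u} := by
    ext u
    simp only [mem_ofPred_eq]
    rw [mulOp_eq_self_iff]
    refine Filter.eventually_congr (Filter.Eventually.of_forall fun x => ?_)
    by_cases hx : x ∈ W <;> simp [hx, eq_comm]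
  rw [this]
  exact isClosed_eq (mulOp _ h1).continuous continuous_id

end Multiplication

/-! ### Invariant multipliers and isotypical components -/

section Isotypical

variable {G : Type*} [Group G] [TopologicalSpace G] {M : Type*} [MulAction G M]
  [TopologicalSpace M] [CompactSpace M] [MeasurableSpace M] [BorelSpace M]
  {F : Type*} {V : M → Type*} [NormedAddCommGroup F] [NormedSpace ℂ F] [FiniteDimensional ℂ F]
  [∀ x, NormedAddCommGroup (V x)] [∀ x, InnerProductSpace ℂ (V x)]
  [TopologicalSpace (TotalSpace F V)] [FiberBundle F V] [VectorBundle ℂ F V]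
  [IsHermitianBundle F V] {μ : Measure M}
  {A : Type*} [NormedAddCommGroup A] [InnerProductSpace ℂ A]
  {ρ : BundleAction G F V} {α : Representation ℂ G A}

theorem isotypicalOn_le {W : Set M} {N : Submodule ℂ (L2 F V μ)} (hN : IsClosed (N : Set (L2 F V μ)))
    (h : ∀ T : A →L[ℂ] L2 F V μ, IsIntertwiner ρ α T →
      (∀ a, ∀ᵐ x ∂μ, x ∉ W → (T a).rep x = 0) → ∀ a, T a ∈ N) : isotypicalOn μ ρ α W ≤ N := by
  refine Submodule.topologicalClosure_minimal _ (Submodule.span_le.2 ?_) hN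
  rintro _ ⟨T, hT, hW, a, rfl⟩
  exact h T hT hW a

theorem mem_isotypicalOn {W : Set M} {T : A →L[ℂ] L2 F V μ} (hT : IsIntertwiner ρ α T)
    (h : ∀ a, ∀ᵐ x ∂μ, x ∉ W → (T a).rep x = 0) (a : A) : T a ∈ isotypicalOn μ ρ α W :=
  Submodule.le_topologicalClosure _ (Submodule.subset_span ⟨T, hT, h, a, rfl⟩)

theorem isClosed_isotypicalOn {W : Set M} :
    IsClosed (isotypicalOn μ ρ α W : Set (L2 F V μ)) :=
  Submodule.isClosed_topologicalClosure _

theorem isotypicalOn_mono {W W' : Set M} (h : W ⊆ W') :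
    isotypicalOn μ ρ α W ≤ isotypicalOn μ ρ α W' :=
  isotypicalOn_le isClosed_isotypicalOn fun _ hT hW a => mem_isotypicalOn hT
    (fun a => (hW a).mono fun _ hx hx' => hx fun h' => hx' (h h')) a

theorem rep_eq_zero_of_mem_isotypicalOn {W : Set M} (hW : MeasurableSet W) {u : L2 F V μ}
    (hu : u ∈ isotypicalOn μ ρ α W) : ∀ᵐ x ∂μ, x ∉ W → u.rep x = 0 := by
  let N : Submodule ℂ (L2 F V μ) :=
    { carrier := {u : L2 F V μ | ∀ᵐ x ∂μ, x ∉ W → u.rep x = 0}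
      add_mem' := fun {u v} hu hv => by
        filter_upwards [hu, hv, L2.rep_add u v] with x h1 h2 h3 hx
        rw [h3, h1 hx, h2 hx, add_zero]
      zero_mem' := L2.rep_zero.mono fun x hx _ => hx
      smul_mem' := fun c u hu => by
        filter_upwards [hu, L2.rep_smul c u] with x h1 h3 hx
        rw [h3, h1 hx, smul_zero] }
  exact isotypicalOn_le (N := N) (isClosed_setOf_rep_eq_zero hW) (fun _ _ h a => h a) hu

/-- Multiplication by an invariant function commutes with the action of the group, so it maps
the `α`-isotypical component to itself; it can only shrink supports. -/
theorem mulOp_mem_isotypicalOn (hμ : ∀ g : G, Measure.QuasiMeasurePreserving (g • · : M → M) μ μ)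
    {m : M → ℂ} (hm : IsMultiplier m) (hinv : ∀ (g : G) x, m (g • x) = m x) {W W' : Set M}
    (hW : ∀ x ∈ W, x ∉ W' → m x = 0) {u : L2 F V μ} (hu : u ∈ isotypicalOn μ ρ α W) :
    mulOp m hm u ∈ isotypicalOn μ ρ α W' := by
  refine isotypicalOn_le (N := (isotypicalOn μ ρ α W').comap (mulOp m hm).toLinearMap)
    (isClosed_isotypicalOn.preimage (mulOp m hm).continuous) ?_ hu
  intro T hT hTW a
  refine mem_isotypicalOn (T := (mulOp m hm).comp T) (fun g a => ?_) (fun a => ?_) a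
  · filter_upwards [hT g a, L2.rep_mulOp hm (T a),
      (hμ g).ae (L2.rep_mulOp hm (T (α g a)))] with y h1 h2 h3
    simp only [ContinuousLinearMap.comp_apply]
    rw [h3, h1, h2, hinv, map_smul]
  · filter_upwards [hTW a, L2.rep_mulOp hm (T a)] with y h1 h2 hy
    simp only [ContinuousLinearMap.comp_apply]
    rw [h2]
    by_cases hyW : y ∈ W
    · rw [hW y hyW hy, zero_smul]
    · rw [h1 hyW, smul_zero]

/-- A section in the isotypical component vanishes on every invariant set that carries no
isotypical section. -/
theorem rep_eq_zero_of_isotypicalOn_eq_bot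
    (hμ : ∀ g : G, Measure.QuasiMeasurePreserving (g • · : M → M) μ μ)
    {W W' : Set M} (hW : MeasurableSet W) (hinv : ∀ (g : G) x, g • x ∈ W ↔ x ∈ W)
    (h0 : isotypicalOn μ ρ α W = ⊥) {u : L2 F V μ} (hu : u ∈ isotypicalOn μ ρ α W') :
    ∀ᵐ x ∂μ, x ∈ W → u.rep x = 0 := by
  have h1 := (isMultiplier_const (M := M) 1).indicator hW
  have h2 := mulOp_mem_isotypicalOn hμ h1 (fun g x => by by_cases hx : x ∈ W <;> simp [hinv, hx])
    (W' := W) (by simp +contextual) hu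
  rw [h0, Submodule.mem_bot, L2.eq_zero_iff_ae] at h2
  filter_upwards [h2, L2.rep_mulOp h1 u] with x h3 h4 hx
  simpa [hx, h4] using h3

end Isotypical

/-! ### Tubes -/

section Tubes

variable {G : Type*} [Group G] [TopologicalSpace G] {M : Type*} [TopologicalSpace M]
  [MulAction G M]

theorem IsTube.isOpen {x : M} {W : Set M} (h : IsTube G x W) : IsOpen W := by
  obtain ⟨S, hS, rfl⟩ := h
  convert hS.isOpenMap.isOpen_range using 1
  ext z
  simp [eq_comm]

theorem IsTube.self_mem {x : M} {W : Set M} (h : IsTube G x W) : x ∈ W := by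
  obtain ⟨S, hS, rfl⟩ := h
  exact ⟨1, x, hS.mem, (one_smul _ _).symm⟩

theorem IsTube.smul_mem_iff {x : M} {W : Set M} (h : IsTube G x W) (g : G) (z : M) :
    g • z ∈ W ↔ z ∈ W := by
  obtain ⟨S, -, rfl⟩ := h
  constructor
  · rintro ⟨k, y, hy, h⟩
    exact ⟨g⁻¹ * k, y, hy, by rw [mul_smul, ← h, inv_smul_smul]⟩
  · rintro ⟨k, y, hy, rfl⟩
    exact ⟨g * k, y, hy, (mul_smul _ _ _).symm⟩

variable (G M) in
/-- The slice property of an action: every point has arbitrarily small slices. -/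
def HasSmallSlices : Prop := ∀ x : M, ∀ U ∈ 𝓝 x, ∃ S ⊆ U, IsSlice G x S

theorem HasSmallSlices.exists_isTube_subset (h : HasSmallSlices G M) {x : M} {U : Set M}
    (hU : U ∈ 𝓝 x) (hinv : ∀ (g : G), ∀ y ∈ U, g • y ∈ U) : ∃ W ⊆ U, IsTube G x W := by
  obtain ⟨S, hSU, hS⟩ := h x U hU
  refine ⟨_, ?_, S, hS, rfl⟩
  rintro _ ⟨g, y, hy, rfl⟩
  exact hinv g y (hSU hy)

end Tubes

/-! ### The operators on the isotypical component -/

section Reduction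

variable {G : Type*} [Group G] [TopologicalSpace G] {M : Type*} [MulAction G M]
  [TopologicalSpace M] [CompactSpace M] [MeasurableSpace M] [BorelSpace M]
  {F : Type*} {V : M → Type*} [NormedAddCommGroup F] [NormedSpace ℂ F] [FiniteDimensional ℂ F]
  [∀ x, NormedAddCommGroup (V x)] [∀ x, InnerProductSpace ℂ (V x)]
  [TopologicalSpace (TotalSpace F V)] [FiberBundle F V] [VectorBundle ℂ F V]
  [IsHermitianBundle F V] {μ : Measure M}
  {A : Type*} [NormedAddCommGroup A] [InnerProductSpace ℂ A]
  {ρ : BundleAction G F V} {α : Representation ℂ G A}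

theorem IsTube.subset_nullSet (hs : HasSmallSlices G M) {x : M} {W : Set M} (hW : IsTube G x W)
    (h0 : isotypicalOn μ ρ α W = ⊥) : W ⊆ nullSet μ ρ α := by
  intro y hy
  obtain ⟨W', hW'W, hW'⟩ := hs.exists_isTube_subset (hW.isOpen.mem_nhds hy)
    fun g z hz => (hW.smul_mem_iff g z).2 hz
  exact ⟨W', hW', le_bot_iff.1 (h0 ▸ isotypicalOn_mono hW'W)⟩

theorem isOpen_nullSet (hs : HasSmallSlices G M) : IsOpen (nullSet μ ρ α : Set M) := by
  refine isOpen_iff_mem_nhds.2 fun x ⟨W, hW, h0⟩ => ?_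
  exact Filter.mem_of_superset (hW.isOpen.mem_nhds hW.self_mem) (hW.subset_nullSet hs h0)

theorem smul_mem_nullSet (hs : HasSmallSlices G M) (g : G) {x : M}
    (hx : x ∈ nullSet μ ρ α) : g • x ∈ nullSet μ ρ α := by
  obtain ⟨W, hW, h0⟩ := hx
  exact hW.subset_nullSet hs h0 ((hW.smul_mem_iff g x).2 hW.self_mem)

/-- As `M` is second countable, countably many of the tubes without isotypical sections cover
`𝒩_α`, so the exceptional null sets can be united. -/
theorem rep_eq_zero_on_nullSet [SecondCountableTopology M]
    (hμ : ∀ g : G, Measure.QuasiMeasurePreserving (g • · : M → M) μ μ)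
    {W : Set M} {u : L2 F V μ} (hu : u ∈ isotypicalOn μ ρ α W) :
    ∀ᵐ x ∂μ, x ∈ nullSet μ ρ α → u.rep x = 0 := by
  have h : ∀ y : M, ∃ W : Set M, y ∈ nullSet μ ρ α → IsTube G y W ∧ isotypicalOn μ ρ α W = ⊥ := by
    intro y
    by_cases hy : y ∈ nullSet μ ρ α
    · obtain ⟨W, hW⟩ := hy
      exact ⟨W, fun _ => hW⟩
    · exact ⟨∅, fun h => (hy h).elim⟩
  choose U hU using h
  obtain ⟨T, hTN, hTc, hT⟩ := TopologicalSpace.isOpen_biUnion_countable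
    (nullSet μ ρ α) U fun y hy => (hU y hy).1.isOpen
  have h1 : ∀ᵐ x ∂μ, ∀ y ∈ T, x ∈ U y → u.rep x = 0 :=
    (ae_ball_iff hTc).2 fun y hy => rep_eq_zero_of_isotypicalOn_eq_bot hμ
      (hU y (hTN hy)).1.isOpen.measurableSet (hU y (hTN hy)).1.smul_mem_iff (hU y (hTN hy)).2 hu
  filter_upwards [h1] with x hx hxN
  have : x ∈ ⋃ y ∈ nullSet μ ρ α, U y := mem_biUnion hxN (hU x hxN).1.self_mem
  rw [← hT] at this
  obtain ⟨y, hy, hxy⟩ := mem_iUnion₂.1 this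
  exact hx y hy hxy

theorem isMultiplier_extendZero {S : Set M} (hS : MeasurableSet S) (f : S →ᵇ ℂ) :
    IsMultiplier (extendZero f) := by
  refine ⟨measurable_of_restrict_of_restrict_compl hS ?_ ?_, ‖f‖, fun x => ?_⟩
  · convert f.continuous.measurable
    ext x
    simp [extendZero]
  · convert measurable_const (a := (0 : ℂ)) with x
    exact dif_neg x.2
  · unfold extendZero
    split_ifs
    · exact f.norm_coe_le_norm _
    · simp

theorem extendZero_smul_eq {S : Set M} (hS : ∀ (g : G), ∀ x ∈ S, g • x ∈ S)
    (f : invariantFunctions G S) (g : G) (x : M) :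
    extendZero (f : S →ᵇ ℂ) (g • x) = extendZero (f : S →ᵇ ℂ) x := by
  by_cases hx : x ∈ S
  · simp only [extendZero, hx, hS g x hx, dif_pos]
    exact f.2 g ⟨x, hx⟩ ⟨g • x, hS g x hx⟩ rfl
  · have : g • x ∉ S := fun h => hx (by simpa using hS g⁻¹ _ h)
    simp [extendZero, hx, this]

/-- The operators `M_f` on the `α`-isotypical component. -/
def mulHom (hμ : ∀ g : G, Measure.QuasiMeasurePreserving (g • · : M → M) μ μ) {S : Set M}
    (hS : MeasurableSet S) (hinv : ∀ (g : G), ∀ x ∈ S, g • x ∈ S) :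
    invariantFunctions G S →ₙₐ[ℂ] (isotypical μ ρ α →L[ℂ] isotypical μ ρ α) :=
  have hext : ∀ {u v : isotypical μ ρ α},
      (∀ᵐ x ∂μ, (u : L2 F V μ).rep x = (v : L2 F V μ).rep x) → u = v :=
    fun h => Subtype.ext (L2.ext_iff_ae.2 h)
  let T (f : invariantFunctions G S) : isotypical μ ρ α →L[ℂ] isotypical μ ρ α :=
    ((mulOp _ (isMultiplier_extendZero hS f)).comp (isotypical μ ρ α).subtypeL).codRestrict _
      fun u => mulOp_mem_isotypicalOn hμ _ (extendZero_smul_eq hinv f) (by simp) u.2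
  have hT (f : invariantFunctions G S) (u : isotypical μ ρ α) : ∀ᵐ x ∂μ,
      (T f u : L2 F V μ).rep x = extendZero (f : S →ᵇ ℂ) x • (u : L2 F V μ).rep x :=
    L2.rep_mulOp _ _
  { toFun := T
    map_smul' := fun c f => by
      ext1 u
      refine hext ?_
      filter_upwards [hT (c • f) u, hT f u, L2.rep_smul c (T f u : L2 F V μ)] with x h1 h2 h3
      refine h1.trans (Eq.trans ?_ h3.symm)
      rw [h2, smul_smul]
      congr 1
      by_cases hx : x ∈ S <;> simp [extendZero, hx]
    map_zero' := by
      ext1 u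
      refine hext ?_
      filter_upwards [hT 0 u, L2.rep_zero (F := F) (V := V) (μ := μ)] with x h1 h2
      refine h1.trans (Eq.trans ?_ h2.symm)
      by_cases hx : x ∈ S <;> simp [extendZero, hx]
    map_add' := fun f g => by
      ext1 u
      refine hext ?_
      filter_upwards [hT (f + g) u, hT f u, hT g u,
        L2.rep_add (T f u : L2 F V μ) (T g u)] with x h1 h2 h3 h4
      refine h1.trans (Eq.trans ?_ h4.symm)
      rw [h2, h3, ← add_smul]
      congr 1
      by_cases hx : x ∈ S <;> simp [extendZero, hx]
    map_mul' := fun f g => by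
      ext1 u
      refine hext ?_
      filter_upwards [hT (f * g) u, hT f (T g u), hT g u] with x h1 h2 h3
      refine h1.trans (Eq.trans ?_ h2.symm)
      rw [h3, smul_smul]
      congr 1
      by_cases hx : x ∈ S <;> simp [extendZero, hx] }

/-- In a tube whose component has least dimension, all smaller tubes carry the same sections, which
therefore vanish outside `⋂ k, U k`. So if the components of all tubes around `x` are nonzero,
none of them can be finite-dimensional. -/
theorem not_finiteDimensional_isotypicalOn (hs : HasSmallSlices G M) {x : M}
    (hx : x ∉ nullSet μ ρ α) {U : ℕ → Set M} (hU : ∀ k, IsOpen (U k)) (hxU : ∀ k, x ∈ U k)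
    (hUinv : ∀ k (g : G), ∀ y ∈ U k, g • y ∈ U k) (h0 : μ (⋂ k, U k) = 0) {W : Set M}
    (hW : IsTube G x W) : ¬ FiniteDimensional ℂ (isotypicalOn μ ρ α W) := by
  intro hfin
  -- a tube inside `W` for which the component has the smallest dimension
  obtain ⟨W₁, ⟨hW₁, hW₁W⟩, hmin⟩ := exists_minimalFor_of_wellFoundedLT
    (fun W' => IsTube G x W' ∧ W' ⊆ W)
    (fun W' => Module.finrank ℂ (isotypicalOn μ ρ α W')) ⟨W, hW, Subset.rfl⟩
  have hfin₁ : FiniteDimensional ℂ (isotypicalOn μ ρ α W₁) :=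
    Submodule.finiteDimensional_of_le (isotypicalOn_mono hW₁W)
  obtain ⟨u, hu, hu0⟩ := (Submodule.ne_bot_iff _).1 fun h => hx ⟨W₁, hW₁, h⟩
  refine hu0 (L2.eq_zero_iff_ae.2 ?_)
  have key : ∀ k, ∀ᵐ y ∂μ, y ∉ U k → u.rep y = 0 := by
    intro k
    obtain ⟨W₂, hW₂U, hW₂⟩ := hs.exists_isTube_subset
      (((hU k).inter hW₁.isOpen).mem_nhds ⟨hxU k, hW₁.self_mem⟩)
      fun g y hy => ⟨hUinv k g y hy.1, (hW₁.smul_mem_iff g y).2 hy.2⟩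
    have hle : isotypicalOn μ ρ α W₂ ≤ isotypicalOn μ ρ α W₁ :=
      isotypicalOn_mono (hW₂U.trans inter_subset_right)
    have heq := Submodule.eq_of_le_of_finrank_le hle
      (hmin ⟨hW₂, (hW₂U.trans inter_subset_right).trans hW₁W⟩ (Submodule.finrank_mono hle))
    rw [← heq] at hu
    filter_upwards [rep_eq_zero_of_mem_isotypicalOn hW₂.isOpen.measurableSet hu] with y hy hyU
    exact hy fun h => hyU (hW₂U h).1
  filter_upwards [ae_all_iff.2 key, measure_eq_zero_iff_ae_notMem.1 h0] with y h1 h2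
  simp only [mem_iInter, not_forall] at h2
  obtain ⟨k, hk⟩ := h2
  exact h1 k hk

/-- If `M_f` is compact, it cannot be bounded below on an infinite-dimensional subspace; a value
`f x ≠ 0` makes it bounded below on the isotypical sections supported in a small tube at `x`. -/
theorem eq_zero_of_isCompactOperator_mulHom [SecondCountableTopology M]
    (hμ : ∀ g : G, Measure.QuasiMeasurePreserving (g • · : M → M) μ μ)
    (hs : HasSmallSlices G M) {P : Set M} (hP : IsClosed P)
    (hPinv : ∀ (g : G), ∀ x ∈ P, g • x ∈ P)
    (hnull : ∀ x ∉ P, ∃ U : ℕ → Set M, (∀ k, IsOpen (U k)) ∧ (∀ k, x ∈ U k) ∧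
      (∀ k (g : G), ∀ y ∈ U k, g • y ∈ U k) ∧ μ (⋂ k, U k) = 0)
    {S : Set M} (hSdef : S = (P ∪ nullSet μ ρ α)ᶜ) (hS : MeasurableSet S)
    (hinv : ∀ (g : G), ∀ x ∈ S, g • x ∈ S) (f : invariantFunctions G S)
    (hf : IsCompactOperator (mulHom (ρ := ρ) (α := α) hμ hS hinv f)) : f = 0 := by
  have hSmem : ∀ y, y ∉ S ↔ y ∈ P ∨ y ∈ nullSet μ ρ α := fun y => by
    rw [hSdef, notMem_compl_iff, mem_union]
  refine Subtype.ext (BoundedContinuousFunction.ext fun x => ?_)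
  by_contra hfx
  have hfx : (f : S →ᵇ ℂ) x ≠ 0 := hfx
  have hxP : (x : M) ∉ P := fun h => (hSmem x).2 (Or.inl h) x.2
  have hxN : (x : M) ∉ nullSet μ ρ α := fun h => (hSmem x).2 (Or.inr h) x.2
  obtain ⟨ε, hε, hεx⟩ := exists_between (norm_pos_iff.2 hfx)
  -- an invariant neighbourhood of `x` where `ε < |f|` on `S` and which misses `P`
  obtain ⟨O, hO, hOS⟩ := isOpen_induced_iff.1
    (isOpen_lt continuous_const ((f : S →ᵇ ℂ).continuous.norm) : IsOpen {y | ε < ‖(f : S →ᵇ ℂ) y‖})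
  have hxO : (x : M) ∈ O := by
    have : x ∈ (Subtype.val ⁻¹' O : Set S) := by rw [hOS]; exact hεx
    exact this
  have hinv' : ∀ (g : G), ∀ y ∈ {y : M | y ∉ P ∧ ∃ g : G, g • y ∈ O},
      g • y ∈ {y : M | y ∉ P ∧ ∃ g : G, g • y ∈ O} := by
    rintro g y ⟨hyP, k, hk⟩
    refine ⟨fun h => hyP (by simpa using hPinv g⁻¹ _ h), k * g⁻¹, ?_⟩
    rwa [smul_smul, inv_mul_cancel_right]
  have hnhds : {y : M | y ∉ P ∧ ∃ g : G, g • y ∈ O} ∈ 𝓝 (x : M) := by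
    filter_upwards [hP.isOpen_compl.mem_nhds hxP, hO.mem_nhds hxO] with y h1 h2
    exact ⟨h1, 1, by simpa using h2⟩
  obtain ⟨W, hWU, hW⟩ := hs.exists_isTube_subset hnhds hinv'
  have hlow : ∀ y (hy : y ∈ S), y ∈ W → ε < ‖(f : S →ᵇ ℂ) ⟨y, hy⟩‖ := by
    intro y hy hyW
    obtain ⟨-, g, hg⟩ := hWU hyW
    have h1 : (⟨g • y, hinv g y hy⟩ : S) ∈ (Subtype.val ⁻¹' O : Set S) := hg
    rw [hOS] at h1
    have h2 := f.2 g ⟨y, hy⟩ ⟨g • y, hinv g y hy⟩ rfl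
    rw [← h2]
    exact h1
  -- the inverse of `f` on `W ∩ S`
  let m : M → ℂ := (W ∩ S).indicator fun y => (extendZero (f : S →ᵇ ℂ) y)⁻¹
  have hm : IsMultiplier m := by
    refine ⟨((isMultiplier_extendZero hS (f : S →ᵇ ℂ)).1.inv).indicator
      (hW.isOpen.measurableSet.inter hS), ε⁻¹, fun y => ?_⟩
    by_cases hy : y ∈ W ∩ S
    · simp only [m, indicator_of_mem hy, norm_inv]
      gcongr
      simpa [extendZero, hy.2] using (hlow y hy.2 hy.1).le
    · simp only [m, indicator_of_notMem hy, norm_zero]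
      positivity
  obtain ⟨U, h1, h2, h3, h4⟩ := hnull x hxP
  refine not_finiteDimensional_isotypicalOn hs hxN h1 h2 h3 h4 hW ?_
  have hle : isotypicalOn μ ρ α W ≤ isotypical μ ρ α := isotypicalOn_mono (subset_univ W)
  have hid : ∀ u ∈ isotypicalOn μ ρ α W,
      mulOp m hm (mulOp _ (isMultiplier_extendZero hS (f : S →ᵇ ℂ)) u) = u := by
    intro u hu
    rw [L2.ext_iff_ae]
    filter_upwards [L2.rep_mulOp hm (mulOp _ (isMultiplier_extendZero hS (f : S →ᵇ ℂ)) u),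
      L2.rep_mulOp (isMultiplier_extendZero hS (f : S →ᵇ ℂ)) u,
      rep_eq_zero_of_mem_isotypicalOn hW.isOpen.measurableSet hu,
      rep_eq_zero_on_nullSet hμ hu] with y h1 h2 h3 h4
    rw [h1, h2, smul_smul]
    by_cases hyW : y ∈ W
    · by_cases hyS : y ∈ S
      · have : extendZero (f : S →ᵇ ℂ) y ≠ 0 := by
          have := hε.trans (hlow y hyS hyW)
          simpa [extendZero, hyS] using this
        simp [m, hyW, hyS, this]
      · have : y ∈ nullSet μ ρ α := ((hSmem y).1 hyS).resolve_left (hWU hyW).1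
        simp [h4 this]
    · simp [h3 hyW]
  let ι : isotypicalOn μ ρ α W →L[ℂ] isotypical μ ρ α :=
    (isotypicalOn μ ρ α W).subtypeL.codRestrict _ fun u => hle u.2
  have hc : IsCompactOperator fun u : isotypicalOn μ ρ α W => (u : L2 F V μ) := by
    have h := (hf.comp_clm ι).clm_comp ((mulOp m hm).comp (isotypical μ ρ α).subtypeL)
    have heq : ⇑((mulOp m hm).comp (isotypical μ ρ α).subtypeL) ∘
        (mulHom (ρ := ρ) (α := α) hμ hS hinv f ∘ ι) =
        fun u : isotypicalOn μ ρ α W => (u : L2 F V μ) := funext fun u => hid u u.2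
    rwa [← heq]
  exact .of_isCompactOperator_id (hc.codRestrict (fun u => u.2) isClosed_isotypicalOn)

end Reduction

/-! ### Maps of constant rank -/

section ConstantRank

variable {E N T : Type*} [NormedAddCommGroup E] [NormedSpace ℝ E] [FiniteDimensional ℝ E]
  [NormedAddCommGroup N] [NormedSpace ℝ N] [FiniteDimensional ℝ N]
  [NormedAddCommGroup T] [NormedSpace ℝ T] [FiniteDimensional ℝ T]

/-- A form of the constant rank theorem: if the rank of `Ψ` near `a` is at most the dimension of
`T`, and `P ∘ Ψ` is a submersion to `T` at `a`, then near `a` the map `Ψ` factors through `P ∘ Ψ`,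
because it has zero derivative along the fibres of this submersion. -/
theorem exists_nhds_eq_of_finrank_range_le {Ψ : E → N} {a : E} (hΨ : ContDiffAt ℝ 1 Ψ a)
    (P : N →L[ℝ] T) (hP : Function.Surjective (P ∘L fderiv ℝ Ψ a))
    (hrank : ∀ᶠ ξ in 𝓝 a, Module.finrank ℝ (fderiv ℝ Ψ ξ).range ≤ Module.finrank ℝ T) :
    ∃ U ∈ 𝓝 a, ∀ ξ ∈ U, ∀ η ∈ U, P (Ψ ξ) = P (Ψ η) → Ψ ξ = Ψ η := by
  set f' := P ∘L fderiv ℝ Ψ a with hf'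
  -- complete `P ∘ Ψ` to a local diffeomorphism `Θ`
  obtain ⟨pr, hpr⟩ := Submodule.ClosedComplemented.of_finiteDimensional f'.ker
  have hΘ : ContDiffAt ℝ 1 (fun ξ => (P (Ψ ξ), pr ξ)) a :=
    (P.contDiff.contDiffAt.comp a hΨ).prodMk pr.contDiff.contDiffAt
  have hΘ' : HasFDerivAt (fun ξ => (P (Ψ ξ), pr ξ)) (f'.prod pr) a :=
    (P.hasFDerivAt.comp a (hΨ.differentiableAt one_ne_zero).hasFDerivAt).prodMk pr.hasFDerivAt
  have hbij : Function.Bijective (f'.prod pr) := by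
    constructor
    · refine (injective_iff_map_eq_zero _).2 fun v hv => ?_
      simp only [ContinuousLinearMap.prod_apply, Prod.mk_eq_zero] at hv
      exact congrArg Subtype.val ((hpr ⟨v, hv.1⟩).symm.trans hv.2)
    · rintro ⟨t, k⟩
      obtain ⟨v, rfl⟩ := hP t
      refine ⟨v - (pr v : E) + k, ?_⟩
      have h1 : f' (pr v : E) = 0 := (pr v).2
      have h2 : f' (k : E) = 0 := k.2
      simp [h1, h2, hpr]
  let e : E ≃L[ℝ] T × f'.ker :=
    (LinearEquiv.ofBijective (f'.prod pr).toLinearMap hbij).toContinuousLinearEquiv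
  have he : HasFDerivAt (fun ξ => (P (Ψ ξ), pr ξ)) (e : E →L[ℝ] T × f'.ker) a := hΘ'
  let Θ := hΘ.toOpenPartialHomeomorph _ he one_ne_zero
  have haΘ : a ∈ Θ.source := hΘ.mem_toOpenPartialHomeomorph_source he one_ne_zero
  have hΘa : ∀ ξ, Θ ξ = (P (Ψ ξ), pr ξ) := fun ξ => rfl
  have hΛ : ContDiffAt ℝ 1 Θ.symm (Θ a) := hΘ.to_localInverse he one_ne_zero
  have hcont : Filter.Tendsto Θ.symm (𝓝 (Θ a)) (𝓝 a) := by
    simpa [Θ.left_inv haΘ] using (Θ.continuousAt_symm (Θ.map_source haΘ)).tendsto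
  have hgood : ∀ᶠ q in 𝓝 (Θ a), q ∈ Θ.target ∧ DifferentiableAt ℝ Θ.symm q ∧
      DifferentiableAt ℝ Ψ (Θ.symm q) ∧
      Module.finrank ℝ (fderiv ℝ Ψ (Θ.symm q)).range ≤ Module.finrank ℝ T := by
    filter_upwards [Θ.open_target.mem_nhds (Θ.map_source haΘ),
      (hΛ.eventually (by simp)).mono fun q h => h.differentiableAt one_ne_zero,
      hcont.eventually ((hΨ.eventually (by simp)).mono fun q h => h.differentiableAt one_ne_zero),
      hcont.eventually hrank] with q h1 h2 h3 h4
    exact ⟨h1, h2, h3, h4⟩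
  obtain ⟨r, hr, hball⟩ := Metric.eventually_nhds_iff_ball.1 hgood
  have hconst : ∀ q ∈ Metric.ball (Θ a) r, ∀ k', (q.1, k') ∈ Metric.ball (Θ a) r →
      Ψ (Θ.symm q) = Ψ (Θ.symm (q.1, k')) := by
    rintro ⟨t, k⟩ hq k' hq'
    rw [← ball_prod_same, mem_prod] at hq hq'
    have hmem : ∀ y ∈ Metric.ball (Θ a).2 r, (t, y) ∈ Metric.ball (Θ a) r := fun y hy => by
      rw [← ball_prod_same]; exact ⟨hq.1, hy⟩
    have hderiv : ∀ y ∈ Metric.ball (Θ a).2 r,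
        HasFDerivAt (fun y : f'.ker => Ψ (Θ.symm (t, y))) (0 : f'.ker →L[ℝ] N) y := by
      intro y hy
      obtain ⟨h1, h2, h3, h4⟩ := hball _ (hmem y hy)
      have hcomp : HasFDerivAt (fun p => P (Ψ (Θ.symm p)))
          (P ∘L fderiv ℝ Ψ (Θ.symm (t, y)) ∘L fderiv ℝ Θ.symm (t, y)) (t, y) :=
        P.hasFDerivAt.comp _ (h3.hasFDerivAt.comp _ h2.hasFDerivAt)
      have hfst : HasFDerivAt (fun p => P (Ψ (Θ.symm p)))
          (ContinuousLinearMap.fst ℝ T f'.ker) (t, y) := by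
        refine hasFDerivAt_fst.congr_of_eventuallyEq ?_
        filter_upwards [Θ.open_target.mem_nhds h1] with p hp
        exact congrArg Prod.fst ((hΘa _).symm.trans (Θ.right_inv hp))
      have heq := hcomp.unique hfst
      -- `P` is injective on the range of the derivative, for dimension reasons
      have hinj : ∀ v ∈ (fderiv ℝ Ψ (Θ.symm (t, y))).range, P v = 0 → v = 0 := by
        set R := (fderiv ℝ Ψ (Θ.symm (t, y))).range
        have hsurj : Function.Surjective (P.toLinearMap.domRestrict R) := fun τ =>
          ⟨⟨_, fderiv ℝ Θ.symm (t, y) (τ, 0), rfl⟩, congrArg (· (τ, 0)) heq⟩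
        have hfr : Module.finrank ℝ R = Module.finrank ℝ T :=
          le_antisymm h4 (LinearMap.finrank_le_finrank_of_surjective hsurj)
        have := (LinearMap.injective_iff_surjective_of_finrank_eq_finrank hfr).2 hsurj
        intro v hv h0
        exact congrArg Subtype.val
          ((injective_iff_map_eq_zero (P.toLinearMap.domRestrict R)).1 this ⟨v, hv⟩ h0)
      have h5 : HasFDerivAt (fun y : f'.ker => Ψ (Θ.symm (t, y)))
          ((fderiv ℝ Ψ (Θ.symm (t, y)) ∘L fderiv ℝ Θ.symm (t, y)) ∘L
            ContinuousLinearMap.inr ℝ T f'.ker) y :=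
        (h3.hasFDerivAt.comp _ h2.hasFDerivAt).comp y (hasFDerivAt_prodMk_right t y)
      convert h5 using 1
      ext1 v
      refine (hinj _ ⟨_, rfl⟩ ?_).symm
      exact congrArg (· (0, v)) heq
    exact Metric.isOpen_ball.is_const_of_fderiv_eq_zero (convex_ball _ _).isPreconnected
      (fun y hy => (hderiv y hy).differentiableAt.differentiableWithinAt)
      (fun y hy => (hderiv y hy).fderiv) hq.2 hq'.2
  refine ⟨Θ.source ∩ Θ ⁻¹' Metric.ball (Θ a) r, Filter.inter_mem (Θ.open_source.mem_nhds haΘ)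
    ((Θ.continuousAt haΘ).preimage_mem_nhds (Metric.ball_mem_nhds _ hr)), ?_⟩
  rintro ξ ⟨h1, h2⟩ η ⟨h3, h4⟩ h
  have h5 : Θ η = ((Θ ξ).1, (Θ η).2) := Prod.ext h.symm rfl
  rw [mem_preimage, h5] at h4
  have := hconst (Θ ξ) h2 _ h4
  rwa [← h5, Θ.left_inv h1, Θ.left_inv h3] at this

/-- A map of constant rank takes, near `a`, no values that it does not already take on a small disc
transverse to the kernel of its derivative. -/
theorem eventually_exists_eq_of_finrank_range_le {Ψ : E → N} {a : E} (hΨ : ContDiffAt ℝ 1 Ψ a)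
    (P : N →L[ℝ] T)
    (hrank : ∀ᶠ ξ in 𝓝 a, Module.finrank ℝ (fderiv ℝ Ψ ξ).range ≤ Module.finrank ℝ T)
    (L : Submodule ℝ E) (hL : Function.Surjective ((P ∘L fderiv ℝ Ψ a) ∘L L.subtypeL))
    {B : Set L} (hB : B ∈ 𝓝 0) : ∀ᶠ ξ in 𝓝 a, ∃ l ∈ B, Ψ (a + l) = Ψ ξ := by
  obtain ⟨U, hU, hUeq⟩ := exists_nhds_eq_of_finrank_range_le hΨ P
    (fun t => (hL t).imp' (fun l : L => (l : E)) fun _ h => h) hrank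
  have h1 : HasStrictFDerivAt (fun l : L => a + (l : E)) L.subtypeL 0 :=
    (L.subtypeL.hasStrictFDerivAt).const_add a
  have hΨ' : HasStrictFDerivAt Ψ (fderiv ℝ Ψ a) (a + ((0 : L) : E)) := by
    simpa using hΨ.hasStrictFDerivAt one_ne_zero
  have h2 : HasStrictFDerivAt (fun l : L => P (Ψ (a + l)))
      ((P ∘L fderiv ℝ Ψ a) ∘L L.subtypeL) 0 :=
    P.hasStrictFDerivAt.comp 0 (hΨ'.comp (f := fun l : L => a + (l : E)) 0 h1)
  have h3 := h2.map_nhds_eq_of_surj (LinearMap.range_eq_top.2 hL)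
  have h4 : B ∩ {l : L | a + (l : E) ∈ U} ∈ 𝓝 (0 : L) := by
    refine Filter.inter_mem hB (h1.continuousAt.preimage_mem_nhds ?_)
    simpa using hU
  have h5 : (fun l : L => P (Ψ (a + l))) '' (B ∩ {l : L | a + (l : E) ∈ U}) ∈ 𝓝 (P (Ψ a)) := by
    have := Filter.image_mem_map (m := fun l : L => P (Ψ (a + l))) h4
    rw [h3] at this
    simpa using this
  filter_upwards [hU, (P.continuous.continuousAt.comp hΨ.continuousAt).preimage_mem_nhds h5]
    with ξ hξ ⟨l, ⟨hlB, hlU⟩, hl⟩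
  exact ⟨l, hlB, hUeq _ hlU _ hξ hl⟩

end ConstantRank

/-! ### Averages of uniformly strictly differentiable families -/

section Average

variable {K N N' : Type*} [TopologicalSpace K] [CompactSpace K] [MeasurableSpace K] [BorelSpace K]
  [NormedAddCommGroup N] [NormedSpace ℝ N] [NormedAddCommGroup N'] [NormedSpace ℝ N']
  [CompleteSpace N']

/-- The average of a family of maps that is strictly differentiable at a point, locally uniformly
in a compact parameter, is strictly differentiable there. -/
theorem hasStrictFDerivAt_integral {ν : Measure K} [IsFiniteMeasure ν] {τ : K → N → N'}
    {A : K → N →L[ℝ] N'} {a : N} (hA : Integrable A ν)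
    (hτ : ∀ᶠ z in 𝓝 a, Integrable (fun k => τ k z) ν)
    (h : ∀ k₀ : K, ∀ ε > 0, ∀ᶠ q : (N × N) × K in 𝓝 ((a, a), k₀),
      ‖τ q.2 q.1.1 - τ q.2 q.1.2 - A q.2 (q.1.1 - q.1.2)‖ ≤ ε * ‖q.1.1 - q.1.2‖) :
    HasStrictFDerivAt (fun z => ∫ k, τ k z ∂ν) (∫ k, A k ∂ν) a := by
  refine .of_isLittleO (Asymptotics.isLittleO_iff.2 fun c hc => ?_)
  have hpos : 0 < ν.real univ + 1 := by positivity
  have hε : 0 < c / (ν.real univ + 1) := by positivity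
  have h1 := isCompact_univ.eventually_forall_of_forall_eventually (x₀ := (a, a))
    (P := fun p k => ‖τ k p.1 - τ k p.2 - A k (p.1 - p.2)‖ ≤
      c / (ν.real univ + 1) * ‖p.1 - p.2‖) fun k _ => h k _ hε
  filter_upwards [h1, (continuous_fst.tendsto (a, a)).eventually hτ,
    (continuous_snd.tendsto (a, a)).eventually hτ] with p hp hp1 hp2
  have hint : ∫ k, τ k p.1 ∂ν - ∫ k, τ k p.2 ∂ν - (∫ k, A k ∂ν) (p.1 - p.2) =
      ∫ k, (τ k p.1 - τ k p.2 - A k (p.1 - p.2)) ∂ν := by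
    rw [ContinuousLinearMap.integral_apply hA, ← integral_sub hp1 hp2]
    exact (integral_sub (hp1.sub hp2) (hA.apply_continuousLinearMap _)).symm
  rw [hint]
  refine (norm_integral_le_of_norm_le_const
    (Filter.Eventually.of_forall fun k => hp k (mem_univ k))).trans ?_
  have : c / (ν.real univ + 1) * ν.real univ ≤ c := by
    rw [div_mul_eq_mul_div, div_le_iff₀ hpos]
    nlinarith
  calc c / (ν.real univ + 1) * ‖p.1 - p.2‖ * ν.real univ
      = c / (ν.real univ + 1) * ν.real univ * ‖p.1 - p.2‖ := by ring
    _ ≤ c * ‖p.1 - p.2‖ := by gcongr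

end Average

/-! ### The action in coordinates -/

section Coordinates

variable {d n : ℕ} {G : Type*} [Group G] [TopologicalSpace G]
  [ChartedSpace (EuclideanSpace ℝ (Fin d)) G] [LieGroup (𝓡 d) ∞ G]
  {M : Type*} [TopologicalSpace M]
  [ChartedSpace (EuclideanSpace ℝ (Fin n)) M] [IsManifold (𝓡 n) ∞ M]
  [MulAction G M] [ContMDiffSMul (𝓡 d) (𝓡 n) ∞ G M]

variable (n) in
/-- The map `y ↦ g • y` in the preferred chart at `x`. -/
def coordAct (x : M) (g : G) (z : EuclideanSpace ℝ (Fin n)) : EuclideanSpace ℝ (Fin n) :=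
  extChartAt (𝓡 n) x (g • (extChartAt (𝓡 n) x).symm z)

variable (d G) in
/-- The inverse of the preferred chart of the group at `1`. -/
def expChart : EuclideanSpace ℝ (Fin d) → G := (extChartAt (𝓡 d) (1 : G)).symm

variable (d G) in
/-- The coordinates of `1` in the preferred chart of the group. -/
def oneCoord : EuclideanSpace ℝ (Fin d) := extChartAt (𝓡 d) (1 : G) 1

variable (d n G) in
/-- The orbit map `g ↦ g • x` in the preferred charts at `1` and `x`. -/
def orbitCoord (x : M) (ξ : EuclideanSpace ℝ (Fin d)) : EuclideanSpace ℝ (Fin n) :=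
  extChartAt (𝓡 n) x (expChart d G ξ • x)

variable (n) in
/-- The derivative of the action of `g` in the preferred chart at `x`; for `g` in the isotropy
group this is the isotropy representation on the tangent space. -/
def linAct (x : M) (g : G) : EuclideanSpace ℝ (Fin n) →L[ℝ] EuclideanSpace ℝ (Fin n) :=
  fderiv ℝ (coordAct n x g) (extChartAt (𝓡 n) x x)

variable (d n G) in
/-- The derivative at `1` of the orbit map of `x`, in coordinates. -/
def orbitDeriv (x : M) : EuclideanSpace ℝ (Fin d) →L[ℝ] EuclideanSpace ℝ (Fin n) :=
  fderiv ℝ (orbitCoord d n G x) (oneCoord d G)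

theorem expChart_oneCoord : expChart d G (oneCoord d G) = 1 := by
  simp [expChart, oneCoord]

theorem contMDiffAt_expChart {ξ : EuclideanSpace ℝ (Fin d)}
    (h : ξ ∈ (extChartAt (𝓡 d) (1 : G)).target) :
    ContMDiffAt 𝓘(ℝ, EuclideanSpace ℝ (Fin d)) (𝓡 d) 1 (expChart d G) ξ :=
  (contMDiffOn_extChartAt_symm (n := 1) (1 : G)).contMDiffAt
    ((isOpen_extChartAt_target (1 : G)).mem_nhds h)

theorem oneCoord_mem_target : oneCoord d G ∈ (extChartAt (𝓡 d) (1 : G)).target :=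
  mem_extChartAt_target 1

theorem continuousAt_expChart : ContinuousAt (expChart d G) (oneCoord d G) :=
  (contMDiffAt_expChart oneCoord_mem_target).continuousAt

theorem contDiffAt_coordAct_prod (x : M) (g : G) (hg : g • x ∈ (extChartAt (𝓡 n) x).source) :
    ContDiffAt ℝ 1 (fun p : EuclideanSpace ℝ (Fin d) × EuclideanSpace ℝ (Fin n) =>
      coordAct n x (g * expChart d G p.1) p.2) (oneCoord d G, extChartAt (𝓡 n) x x) := by
  rw [← contMDiffAt_iff_contDiffAt]
  have h1 : ContMDiffAt 𝓘(ℝ, EuclideanSpace ℝ (Fin d) × EuclideanSpace ℝ (Fin n)) (𝓡 d) 1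
      (fun p : EuclideanSpace ℝ (Fin d) × EuclideanSpace ℝ (Fin n) => g * expChart d G p.1)
      (oneCoord d G, extChartAt (𝓡 n) x x) :=
    contMDiffAt_const.mul (ContMDiffAt.comp (oneCoord d G, extChartAt (𝓡 n) x x)
      (contMDiffAt_expChart (oneCoord_mem_target (G := G))) contDiff_fst.contMDiff.contMDiffAt)
  have h2 : ContMDiffAt 𝓘(ℝ, EuclideanSpace ℝ (Fin d) × EuclideanSpace ℝ (Fin n)) (𝓡 n) 1
      (fun p : EuclideanSpace ℝ (Fin d) × EuclideanSpace ℝ (Fin n) =>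
        (extChartAt (𝓡 n) x).symm p.2)
      (oneCoord d G, extChartAt (𝓡 n) x x) :=
    ((contMDiffOn_extChartAt_symm (n := 1) x).contMDiffAt
      ((isOpen_extChartAt_target x).mem_nhds (mem_extChartAt_target x))).comp
      (oneCoord d G, extChartAt (𝓡 n) x x) (contDiff_snd.contMDiff.contMDiffAt)
  have h3 := h1.smul h2
  refine ContMDiffAt.comp (oneCoord d G, extChartAt (𝓡 n) x x)
    (contMDiffAt_extChartAt' (x := x) (I := 𝓡 n) (n := 1) ?_) h3
  simpa [expChart_oneCoord] using hg

theorem contDiffAt_coordAct (d : ℕ) [ChartedSpace (EuclideanSpace ℝ (Fin d)) G]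
    [LieGroup (𝓡 d) ∞ G] [ContMDiffSMul (𝓡 d) (𝓡 n) ∞ G M]
    (x : M) (g : G) (hg : g • x ∈ (extChartAt (𝓡 n) x).source) :
    ContDiffAt ℝ 1 (coordAct n x g) (extChartAt (𝓡 n) x x) := by
  have h := (contDiffAt_coordAct_prod (d := d) x g hg).comp (extChartAt (𝓡 n) x x)
    (contDiffAt_const.prodMk contDiffAt_id (f := fun _ => oneCoord d G))
  simpa [Function.comp_def, expChart_oneCoord] using h

theorem contDiffAt_orbitCoord (x : M) :
    ContDiffAt ℝ 1 (orbitCoord d n G x) (oneCoord d G) := by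
  have h := (contDiffAt_coordAct_prod (d := d) (n := n) x (1 : G) (by simp)).comp (oneCoord d G)
    (contDiffAt_id.prodMk contDiffAt_const (g := fun _ => extChartAt (𝓡 n) x x))
  simp only [Function.comp_def, coordAct, id, one_mul, extChartAt_to_inv] at h
  exact h

theorem contDiffAt_expChart_conj (k₁ k₂ : G) {ξ : EuclideanSpace ℝ (Fin d)}
    (hξ : ξ ∈ (extChartAt (𝓡 d) (1 : G)).target) (h : k₁ * expChart d G ξ * k₂ = 1) :
    ContDiffAt ℝ 1 (fun η => extChartAt (𝓡 d) (1 : G) (k₁ * expChart d G η * k₂)) ξ := by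
  rw [← contMDiffAt_iff_contDiffAt]
  refine ContMDiffAt.comp ξ (contMDiffAt_extChartAt' (x := 1) (I := 𝓡 d) (n := 1) ?_)
    ((contMDiffAt_const.mul (contMDiffAt_expChart hξ)).mul contMDiffAt_const)
  rw [h]
  exact mem_chart_source _ _

theorem coordAct_self {x : M} {g : G} (hg : g • x = x) :
    coordAct n x g (extChartAt (𝓡 n) x x) = extChartAt (𝓡 n) x x := by
  simp [coordAct, hg]

theorem orbitCoord_oneCoord (x : M) : orbitCoord d n G x (oneCoord d G) = extChartAt (𝓡 n) x x := by
  simp [orbitCoord, expChart_oneCoord]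

/-- Homogeneity of the orbit map: near a point where `g = k k'⁻¹`, it is `g ↦ k⁻¹ g k'`, followed by
the orbit map near `1`, followed by the action of `k`. Applied at other points than `1`, this gives
the constancy of the rank; applied with `k` in the isotropy group, the invariance of the range. -/
theorem orbitCoord_eventuallyEq [IsTopologicalGroup G] [ContinuousSMul G M] (x : M) (k k' : G)
    (hk' : k' • x = x) (ξ : EuclideanSpace ℝ (Fin d))
    (hξ : ξ ∈ (extChartAt (𝓡 d) (1 : G)).target) (h : k⁻¹ * expChart d G ξ * k' = 1) :
    orbitCoord d n G x =ᶠ[𝓝 ξ] coordAct n x k ∘ orbitCoord d n G x ∘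
      fun η => extChartAt (𝓡 d) (1 : G) (k⁻¹ * expChart d G η * k') := by
  have hc : ContinuousAt (fun η => k⁻¹ * expChart d G η * k') ξ :=
    ((continuousAt_const.mul (contMDiffAt_expChart hξ).continuousAt).mul continuousAt_const)
  have h1 : ∀ᶠ η in 𝓝 ξ, k⁻¹ * expChart d G η * k' ∈ (extChartAt (𝓡 d) (1 : G)).source := by
    refine hc.preimage_mem_nhds ?_
    rw [h]
    exact extChartAt_source_mem_nhds 1
  have h2 : ∀ᶠ η in 𝓝 ξ, (k⁻¹ * expChart d G η * k') • x ∈ (extChartAt (𝓡 n) x).source := by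
    refine (hc.smul continuousAt_const).preimage_mem_nhds ?_
    change _ ∈ 𝓝 ((k⁻¹ * expChart d G ξ * k') • x)
    rw [h, one_smul]
    exact extChartAt_source_mem_nhds x
  filter_upwards [h1, h2] with η h1 h2
  have h3 : expChart d G (extChartAt (𝓡 d) (1 : G) (k⁻¹ * expChart d G η * k')) =
      k⁻¹ * expChart d G η * k' := (extChartAt (𝓡 d) (1 : G)).left_inv h1
  simp only [Function.comp, coordAct, orbitCoord, h3, (extChartAt (𝓡 n) x).left_inv h2]
  rw [smul_smul, mul_assoc, mul_inv_cancel_left, mul_smul, hk']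

theorem fderiv_orbitCoord_eq [IsTopologicalGroup G] [ContinuousSMul G M] (x : M) (k k' : G)
    (hk' : k' • x = x) (hk : k • x ∈ (extChartAt (𝓡 n) x).source)
    (ξ : EuclideanSpace ℝ (Fin d))
    (hξ : ξ ∈ (extChartAt (𝓡 d) (1 : G)).target) (h : k⁻¹ * expChart d G ξ * k' = 1) :
    fderiv ℝ (orbitCoord d n G x) ξ = linAct n x k ∘L orbitDeriv d n G x ∘L
      fderiv ℝ (fun η => extChartAt (𝓡 d) (1 : G) (k⁻¹ * expChart d G η * k')) ξ := by
  rw [(orbitCoord_eventuallyEq x k k' hk' ξ hξ h).fderiv_eq]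
  have hv : extChartAt (𝓡 d) (1 : G) (k⁻¹ * expChart d G ξ * k') = oneCoord d G := by
    rw [h]; rfl
  have h3 := ((contDiffAt_expChart_conj k⁻¹ k' hξ h).differentiableAt one_ne_zero).hasFDerivAt
  have h2 := ((contDiffAt_orbitCoord (n := n) (d := d) (G := G) x).differentiableAt
    one_ne_zero).hasFDerivAt
  have h1 := ((contDiffAt_coordAct (n := n) d x k hk).differentiableAt one_ne_zero).hasFDerivAt
  rw [← orbitCoord_oneCoord (d := d) (n := n) (G := G) x] at h1
  rw [← hv] at h2
  have h4 := h2.comp ξ h3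
  rw [← hv] at h1
  have h5 := HasFDerivAt.comp (g := coordAct n x k) ξ h1 h4
  rw [h5.fderiv]
  rw [hv, orbitCoord_oneCoord]
  rfl

/-- The orbit map has constant rank. -/
theorem eventually_finrank_range_orbitCoord_le [IsTopologicalGroup G] [ContinuousSMul G M] (x : M) :
    ∀ᶠ ξ in 𝓝 (oneCoord d G), Module.finrank ℝ (fderiv ℝ (orbitCoord d n G x) ξ).range ≤
      Module.finrank ℝ (orbitDeriv d n G x).range := by
  have h1 : ∀ᶠ ξ in 𝓝 (oneCoord d G), expChart d G ξ • x ∈ (extChartAt (𝓡 n) x).source := by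
    refine (continuousAt_expChart.smul continuousAt_const).preimage_mem_nhds ?_
    change _ ∈ 𝓝 (expChart d G (oneCoord d G) • x)
    rw [expChart_oneCoord, one_smul]
    exact extChartAt_source_mem_nhds x
  filter_upwards [h1, (isOpen_extChartAt_target (1 : G)).mem_nhds oneCoord_mem_target]
    with ξ h1 h2
  rw [fderiv_orbitCoord_eq x (expChart d G ξ) 1 (one_smul _ _) h1 ξ h2 (by simp)]
  refine (Submodule.finrank_mono ?_).trans
    (Submodule.finrank_map_le (linAct n x (expChart d G ξ)).toLinearMap (orbitDeriv d n G x).range)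
  rintro _ ⟨v, rfl⟩
  exact ⟨_, ⟨_, rfl⟩, rfl⟩

theorem linAct_mul [ContinuousSMul G M] (d : ℕ) [ChartedSpace (EuclideanSpace ℝ (Fin d)) G]
    [LieGroup (𝓡 d) ∞ G] [ContMDiffSMul (𝓡 d) (𝓡 n) ∞ G M] {x : M} {h k : G}
    (hh : h • x = x) (hk : k • x = x) :
    linAct n x (h * k) = linAct n x h ∘L linAct n x k := by
  have h1 : coordAct n x (h * k) =ᶠ[𝓝 (extChartAt (𝓡 n) x x)] coordAct n x h ∘ coordAct n x k := by
    have : ∀ᶠ z in 𝓝 (extChartAt (𝓡 n) x x),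
        k • (extChartAt (𝓡 n) x).symm z ∈ (extChartAt (𝓡 n) x).source := by
      refine ((continuousAt_extChartAt_symm x).const_smul k).preimage_mem_nhds ?_
      change _ ∈ 𝓝 (k • (extChartAt (𝓡 n) x).symm (extChartAt (𝓡 n) x x))
      rw [extChartAt_to_inv, hk]
      exact extChartAt_source_mem_nhds x
    filter_upwards [this] with z hz
    simp only [coordAct, Function.comp, (extChartAt (𝓡 n) x).left_inv hz, mul_smul]
  have hd : ∀ {g : G}, g • x = x → HasFDerivAt (coordAct n x g) (linAct n x g)
      (extChartAt (𝓡 n) x x) := fun {g} hg =>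
    ((contDiffAt_coordAct d x g (by rw [hg]; exact mem_extChartAt_source x)).differentiableAt
      one_ne_zero).hasFDerivAt
  have h2 := hd hh
  rw [← coordAct_self hk] at h2
  exact ((h2.comp _ (hd hk)).congr_of_eventuallyEq h1).fderiv

theorem linAct_one (x : M) : linAct n x (1 : G) = ContinuousLinearMap.id ℝ _ := by
  have h1 : coordAct n x (1 : G) =ᶠ[𝓝 (extChartAt (𝓡 n) x x)] id := by
    filter_upwards [(isOpen_extChartAt_target x).mem_nhds (mem_extChartAt_target x)] with z hz
    simp only [coordAct, one_smul, id, (extChartAt (𝓡 n) x).right_inv hz]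
  rw [linAct, h1.fderiv_eq, fderiv_id]

/-- The isotropy representation preserves the tangent space of the orbit. -/
theorem linAct_orbitDeriv_mem_range [IsTopologicalGroup G] [ContinuousSMul G M] (x : M) {h : G}
    (hh : h • x = x) (v : EuclideanSpace ℝ (Fin d)) :
    linAct n x h (orbitDeriv d n G x v) ∈ (orbitDeriv d n G x).range := by
  have hh' : h⁻¹ • x = x := by rw [inv_smul_eq_iff, hh]
  obtain ⟨C, hC⟩ : ∃ C, orbitDeriv d n G x = linAct n x h⁻¹ ∘L orbitDeriv d n G x ∘L C :=
    ⟨_, fderiv_orbitCoord_eq (d := d) (n := n) x h⁻¹ h⁻¹ hh'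
      (by rw [hh']; exact mem_extChartAt_source x) (oneCoord d G) oneCoord_mem_target
      (by simp [expChart_oneCoord])⟩
  have h2 : linAct n x h ∘L orbitDeriv d n G x = orbitDeriv d n G x ∘L C := by
    conv_lhs => rw [hC, ← ContinuousLinearMap.comp_assoc, ← linAct_mul d hh hh',
      mul_inv_cancel, linAct_one, ContinuousLinearMap.id_comp]
  exact ⟨C v, (congrArg (· v) h2).symm⟩

end Coordinates

/-! ### An equivariant map whose zero set is a slice -/

section SliceFunction

variable {d n : ℕ} {G : Type*} [Group G] [TopologicalSpace G] [IsTopologicalGroup G]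
  [ChartedSpace (EuclideanSpace ℝ (Fin d)) G] [LieGroup (𝓡 d) ∞ G]
  {M : Type*} [EMetricSpace M]
  [ChartedSpace (EuclideanSpace ℝ (Fin n)) M] [IsManifold (𝓡 n) ∞ M]
  [MulAction G M] [ContMDiffSMul (𝓡 d) (𝓡 n) ∞ G M] [ContinuousSMul G M]

/-- In coordinates, the maps `y ↦ g' • y` for `g'` near `g` in the isotropy group are uniformly close
to the linear map `linAct n x g` in the sense of strict differentiability at `x`. -/
theorem eventually_coordAct_sub_le (d : ℕ) [ChartedSpace (EuclideanSpace ℝ (Fin d)) G]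
    [LieGroup (𝓡 d) ∞ G] [ContMDiffSMul (𝓡 d) (𝓡 n) ∞ G M] {x : M} {g : G} (hg : g • x = x)
    {ε : ℝ} (hε : 0 < ε) :
    ∀ᶠ q : (EuclideanSpace ℝ (Fin n) × EuclideanSpace ℝ (Fin n)) × G in
      𝓝 ((extChartAt (𝓡 n) x x, extChartAt (𝓡 n) x x), g),
      ‖coordAct n x q.2 q.1.1 - coordAct n x q.2 q.1.2 - linAct n x g (q.1.1 - q.1.2)‖ ≤
        ε * ‖q.1.1 - q.1.2‖ := by
  set a := extChartAt (𝓡 n) x x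
  have hgs : g • x ∈ (extChartAt (𝓡 n) x).source := by rw [hg]; exact mem_extChartAt_source x
  have hc := (contDiffAt_coordAct_prod (d := d) (n := n) x g hgs).hasStrictFDerivAt one_ne_zero
  set c := fun p : EuclideanSpace ℝ (Fin d) × EuclideanSpace ℝ (Fin n) =>
      coordAct n x (g * expChart d G p.1) p.2 with hcdef
  have hlin : ∀ w, fderiv ℝ c (oneCoord d G, a) (0, w) = linAct n x g w := by
    intro w
    have h1 := hc.hasFDerivAt.comp a (hasFDerivAt_prodMk_right (oneCoord d G) a)
    have h2 : c ∘ (fun z => (oneCoord d G, z)) = coordAct n x g := by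
      ext1 z
      simp [hcdef, expChart_oneCoord]
    rw [h2] at h1
    rw [linAct, h1.fderiv]
    rfl
  have h1 := (Asymptotics.isLittleO_iff.1 hc.isLittleO) hε
  let u : (EuclideanSpace ℝ (Fin n) × EuclideanSpace ℝ (Fin n)) × G →
      (EuclideanSpace ℝ (Fin d) × EuclideanSpace ℝ (Fin n)) ×
        (EuclideanSpace ℝ (Fin d) × EuclideanSpace ℝ (Fin n)) := fun q =>
    ((extChartAt (𝓡 d) (1 : G) (g⁻¹ * q.2), q.1.1), (extChartAt (𝓡 d) (1 : G) (g⁻¹ * q.2), q.1.2))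
  have hg1 : ContinuousAt (fun q : (EuclideanSpace ℝ (Fin n) × EuclideanSpace ℝ (Fin n)) × G =>
      g⁻¹ * q.2) ((a, a), g) := by fun_prop
  have hu1 : ContinuousAt (fun q : (EuclideanSpace ℝ (Fin n) × EuclideanSpace ℝ (Fin n)) × G =>
      extChartAt (𝓡 d) (1 : G) (g⁻¹ * q.2)) ((a, a), g) := by
    refine ContinuousAt.comp (f := fun q : (EuclideanSpace ℝ (Fin n) ×
      EuclideanSpace ℝ (Fin n)) × G => g⁻¹ * q.2) ?_ hg1
    simp only [inv_mul_cancel]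
    exact continuousAt_extChartAt 1
  have hu : Filter.Tendsto u (𝓝 ((a, a), g)) (𝓝 ((oneCoord d G, a), (oneCoord d G, a))) := by
    have : u ((a, a), g) = ((oneCoord d G, a), (oneCoord d G, a)) := by
      simp [u, oneCoord]
    rw [← this]
    exact (hu1.prodMk (by fun_prop)).prodMk (hu1.prodMk (by fun_prop))
  have hsrc : ∀ᶠ q : (EuclideanSpace ℝ (Fin n) × EuclideanSpace ℝ (Fin n)) × G in
      𝓝 ((a, a), g), g⁻¹ * q.2 ∈ (extChartAt (𝓡 d) (1 : G)).source := by
    refine hg1.preimage_mem_nhds ?_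
    simp only [inv_mul_cancel]
    exact extChartAt_source_mem_nhds 1
  filter_upwards [hu.eventually h1, hsrc] with q hq hs
  have h3 : expChart d G (extChartAt (𝓡 d) (1 : G) (g⁻¹ * q.2)) = g⁻¹ * q.2 :=
    (extChartAt (𝓡 d) (1 : G)).left_inv hs
  have h4 : ∀ z, c (extChartAt (𝓡 d) (1 : G) (g⁻¹ * q.2), z) = coordAct n x q.2 z := fun z => by
    simp only [hcdef]
    rw [h3, mul_inv_cancel_left]
  have h5 : (u q).1 - (u q).2 = (0, q.1.1 - q.1.2) := by simp [u]
  rw [h5, hlin, h4, h4, Prod.norm_mk, norm_zero, max_eq_right (norm_nonneg _)] at hq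
  exact hq

theorem continuousOn_linAct (d : ℕ) [ChartedSpace (EuclideanSpace ℝ (Fin d)) G]
    [LieGroup (𝓡 d) ∞ G] [ContMDiffSMul (𝓡 d) (𝓡 n) ∞ G M] (x : M) :
    ContinuousOn (linAct n x : G → _) {g | g • x = x} := by
  intro g hg
  refine Metric.tendsto_nhds.2 fun ε hε => ?_
  have h1 := eventually_coordAct_sub_le (n := n) d hg (half_pos hε)
  rw [nhds_prod_eq] at h1
  have h2 := (Filter.eventually_swap_iff.1 h1).curry
  filter_upwards [nhdsWithin_le_nhds h2, self_mem_nhdsWithin] with k hk hkx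
  rw [dist_eq_norm]
  refine lt_of_le_of_lt ?_ (half_lt_self hε)
  have hd : HasFDerivAt (coordAct n x k) (linAct n x k) (extChartAt (𝓡 n) x x) :=
    ((contDiffAt_coordAct d x k (by rw [hkx]; exact mem_extChartAt_source x)).differentiableAt
      one_ne_zero).hasFDerivAt
  have hd' := hd.sub (linAct n x g).hasFDerivAt
  refine hd'.le_of_lip' (half_pos hε).le ?_
  have h3 : Filter.Tendsto (fun z => (z, extChartAt (𝓡 n) x x)) (𝓝 (extChartAt (𝓡 n) x x))
      (𝓝 (extChartAt (𝓡 n) x x, extChartAt (𝓡 n) x x)) := by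
    exact (by fun_prop : Continuous fun z => (z, extChartAt (𝓡 n) x x)).tendsto _
  filter_upwards [h3.eventually hk] with z hz
  refine le_of_eq_of_le (congrArg _ ?_) hz
  simp only [Pi.sub_apply, map_sub, Prod.swap]
  abel

variable [CompactSpace G] [T2Space G] [IsIsometricSMul G M]

/-- Averaging the coordinate projection to the tangent space `T` of the orbit over the isotropy
group gives an equivariant map to `T` that restricts to the identity of `T` to first order. -/
theorem exists_equivariant_submersion (x : M) :
    ∃ (r : ℝ≥0∞) (ψ : M → EuclideanSpace ℝ (Fin n))
      (Q : EuclideanSpace ℝ (Fin n) →L[ℝ] EuclideanSpace ℝ (Fin n)), 0 < r ∧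
      Metric.eball x r ⊆ (extChartAt (𝓡 n) x).source ∧ ψ x = 0 ∧
      (∀ h : G, h • x = x → ∀ y ∈ Metric.eball x r, ψ (h • y) = linAct n x h (ψ y)) ∧
      (∀ y ∈ Metric.eball x r, ψ y ∈ (orbitDeriv d n G x).range) ∧
      HasStrictFDerivAt (ψ ∘ (extChartAt (𝓡 n) x).symm) Q (extChartAt (𝓡 n) x x) ∧
      ∀ v, Q (orbitDeriv d n G x v) = orbitDeriv d n G x v := by
  set a := extChartAt (𝓡 n) x x with ha
  set T := (orbitDeriv d n G x).range with hT
  let P := T.starProjection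
  let H := MulAction.stabilizer G x
  have hH : ∀ h : H, (h : G) • x = x := fun h => h.2
  have : CompactSpace H := by
    refine isCompact_iff_compactSpace.1 (IsClosed.isCompact ?_)
    exact isClosed_eq (continuous_id.smul continuous_const) continuous_const
  let _ : MeasurableSpace H := borel H
  have : BorelSpace H := ⟨rfl⟩
  let ν : Measure H := Measure.haarMeasure ⊤
  have : IsProbabilityMeasure ν := ⟨by
    have := Measure.haarMeasure_self (G := H) (K₀ := ⊤)
    simpa using this⟩
  have hB : Continuous fun h : H => linAct n x (h : G) :=
    (continuousOn_linAct d x).comp_continuous continuous_subtype_val hH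
  have hBinv : Continuous fun h : H => linAct n x ((h : G)⁻¹) := by
    exact hB.comp continuous_inv
  have hPB : ∀ (h : H) v, P (linAct n x (h : G) (P v)) = linAct n x (h : G) (P v) := by
    intro h v
    obtain ⟨w, hw⟩ : P v ∈ T := T.starProjection_apply_mem v
    rw [← hw]
    exact Submodule.starProjection_eq_self_iff.2 (linAct_orbitDeriv_mem_range x (hH h) w)
  obtain ⟨r, hr, hball⟩ := EMetric.mem_nhds_iff.1 (extChartAt_source_mem_nhds (I := 𝓡 n) x)
  have hsmul : ∀ h : G, h • x = x → ∀ y ∈ Metric.eball x r, h • y ∈ Metric.eball x r := by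
    intro h hh y hy
    rw [Metric.mem_eball] at hy ⊢
    rwa [← hh, edist_smul_left]
  have hinv : ∀ h : G, h • x = x → h⁻¹ • x = x := fun h hh => by rw [inv_smul_eq_iff, hh]
  -- the conjugate by `h` of the coordinate projection; the average over `h` is equivariant
  let τ : H → M → EuclideanSpace ℝ (Fin n) := fun h y =>
    linAct n x (h : G) (P (extChartAt (𝓡 n) x ((h : G)⁻¹ • y) - a))
  have hτc : ∀ y ∈ Metric.eball x r, Continuous fun h => τ h y := by
    intro y hy
    refine hB.clm_apply (P.continuous.comp (Continuous.sub ?_ continuous_const))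
    refine (continuousOn_extChartAt x).comp_continuous
      ((continuous_subtype_val.inv).smul continuous_const) fun h => ?_
    exact hball (hsmul _ (hinv _ (hH h)) y hy)
  have hτi : ∀ y ∈ Metric.eball x r, Integrable (fun h => τ h y) ν := fun y hy =>
    (hτc y hy).integrable_of_hasCompactSupport (HasCompactSupport.of_compactSpace _)
  let A : H → EuclideanSpace ℝ (Fin n) →L[ℝ] EuclideanSpace ℝ (Fin n) := fun h =>
    linAct n x (h : G) ∘L P ∘L linAct n x ((h : G)⁻¹)
  have hAi : Integrable A ν :=
    (hB.clm_comp (continuous_const.clm_comp hBinv)).integrable_of_hasCompactSupport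
      (HasCompactSupport.of_compactSpace _)
  refine ⟨r, fun y => ∫ h, τ h y ∂ν, ∫ h, A h ∂ν, hr, hball, ?_, ?_, ?_, ?_, ?_⟩
  · have : ∀ h : H, τ h x = 0 := fun h => by simp [τ, hinv _ (hH h), ha]
    simp [this]
  · intro k hk y hy
    have h1 := integral_mul_left_eq_self (μ := ν) (fun h => τ h (k • y)) ⟨k, hk⟩
    change ∫ h, τ h (k • y) ∂ν = linAct n x k (∫ h, τ h y ∂ν)
    rw [← h1, ← ContinuousLinearMap.integral_comp_comm _ (hτi y hy)]
    refine integral_congr_ae (Filter.Eventually.of_forall fun h => ?_)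
    simp only [τ, Subgroup.coe_mul]
    rw [linAct_mul d hk (hH h), mul_inv_rev, mul_smul, inv_smul_smul]
    rfl
  · intro y hy
    refine Submodule.starProjection_eq_self_iff.1 ?_
    change P (∫ h, τ h y ∂ν) = _
    rw [← ContinuousLinearMap.integral_comp_comm _ (hτi y hy)]
    exact integral_congr_ae (Filter.Eventually.of_forall fun h => hPB h _)
  · refine hasStrictFDerivAt_integral (τ := fun h z => τ h ((extChartAt (𝓡 n) x).symm z)) hAi ?_ ?_
    · have : ∀ᶠ z in 𝓝 a, (extChartAt (𝓡 n) x).symm z ∈ Metric.eball x r := by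
        refine (continuousAt_extChartAt_symm x).preimage_mem_nhds ?_
        rw [extChartAt_to_inv]
        exact Metric.eball_mem_nhds x hr
      exact this.mono fun z hz => hτi _ hz
    · intro h₀ ε hε
      set C := ‖linAct n x (h₀ : G)‖ + 1 with hC
      have hCpos : 0 < C := by positivity
      have hε' : 0 < ε / (2 * C) := by positivity
      have h1 := eventually_coordAct_sub_le (n := n) d (hinv _ (hH h₀)) hε'
      have h2 : Filter.Tendsto (fun q : (EuclideanSpace ℝ (Fin n) × EuclideanSpace ℝ (Fin n)) × H =>
          (q.1, (q.2 : G)⁻¹)) (𝓝 ((a, a), h₀)) (𝓝 ((a, a), (h₀ : G)⁻¹)) :=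
        (by fun_prop : Continuous fun q : (EuclideanSpace ℝ (Fin n) ×
          EuclideanSpace ℝ (Fin n)) × H => (q.1, (q.2 : G)⁻¹)).tendsto _
      have h3 : ∀ᶠ q : (EuclideanSpace ℝ (Fin n) × EuclideanSpace ℝ (Fin n)) × H in
          𝓝 ((a, a), h₀), ‖linAct n x (q.2 : G)‖ < C :=
        (hB.comp continuous_snd).norm.continuousAt.eventually_lt_const (lt_add_one _)
      have h4 : ∀ᶠ q : (EuclideanSpace ℝ (Fin n) × EuclideanSpace ℝ (Fin n)) × H in
          𝓝 ((a, a), h₀), ‖linAct n x ((h₀ : G)⁻¹) - linAct n x ((q.2 : G)⁻¹)‖ < ε / (2 * C) := by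
        refine (continuous_const.sub (hBinv.comp continuous_snd)).norm.continuousAt.eventually_lt_const ?_
        simpa using hε'
      filter_upwards [h2.eventually h1, h3, h4] with q h1 h3 h4
      simp only [τ, A, ContinuousLinearMap.comp_apply]
      rw [← map_sub, ← map_sub, ← map_sub, ← map_sub]
      set w := q.1.1 - q.1.2
      have h5 : coordAct n x ((q.2 : G)⁻¹) q.1.1 - a - (coordAct n x ((q.2 : G)⁻¹) q.1.2 - a) -
          linAct n x ((q.2 : G)⁻¹) w = (coordAct n x ((q.2 : G)⁻¹) q.1.1 -
          coordAct n x ((q.2 : G)⁻¹) q.1.2 - linAct n x ((h₀ : G)⁻¹) w) +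
          (linAct n x ((h₀ : G)⁻¹) - linAct n x ((q.2 : G)⁻¹)) w := by
        rw [sub_apply]
        abel
      calc _ ≤ C * ‖P (coordAct n x ((q.2 : G)⁻¹) q.1.1 - a -
            (coordAct n x ((q.2 : G)⁻¹) q.1.2 - a) - linAct n x ((q.2 : G)⁻¹) w)‖ :=
            (ContinuousLinearMap.le_opNorm _ _).trans
              (mul_le_mul_of_nonneg_right h3.le (norm_nonneg _))
        _ ≤ C * (ε / (2 * C) * ‖w‖ + ε / (2 * C) * ‖w‖) := by
            refine mul_le_mul_of_nonneg_left ((T.norm_starProjection_apply_le _).trans ?_) hCpos.le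
            rw [h5]
            refine (norm_add_le _ _).trans (add_le_add h1
              ((ContinuousLinearMap.le_opNorm _ _).trans ?_))
            exact mul_le_mul_of_nonneg_right h4.le (norm_nonneg _)
        _ = ε * ‖w‖ := by field_simp; ring
  · intro v
    rw [ContinuousLinearMap.integral_apply hAi]
    have : ∀ h : H, A h (orbitDeriv d n G x v) = orbitDeriv d n G x v := by
      intro h
      simp only [A, ContinuousLinearMap.comp_apply]
      have h1 : P (linAct n x ((h : G)⁻¹) (orbitDeriv d n G x v)) = _ :=
        Submodule.starProjection_eq_self_iff.2
          (linAct_orbitDeriv_mem_range x (hinv _ (hH h)) v)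
      rw [h1, ← ContinuousLinearMap.comp_apply, ← linAct_mul d (hH h) (hinv _ (hH h)),
        mul_inv_cancel, linAct_one]
      rfl
    simp [this]

end SliceFunction

/-! ### Existence of slices -/

section SliceTheorem

variable {d n : ℕ} {G : Type*} [Group G] [TopologicalSpace G] [IsTopologicalGroup G]
  [ChartedSpace (EuclideanSpace ℝ (Fin d)) G] [LieGroup (𝓡 d) ∞ G]
  {M : Type*} [EMetricSpace M]
  [ChartedSpace (EuclideanSpace ℝ (Fin n)) M] [IsManifold (𝓡 n) ∞ M]
  [MulAction G M] [ContMDiffSMul (𝓡 d) (𝓡 n) ∞ G M] [ContinuousSMul G M]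
  [CompactSpace G] [T2Space G] [IsIsometricSMul G M]

variable (d n G) in
/-- A complement of the Lie algebra of the isotropy group of `x`, in coordinates. -/
def transversal (x : M) : Submodule ℝ (EuclideanSpace ℝ (Fin d)) := (orbitDeriv d n G x).kerᗮ

theorem bijective_orbitDeriv_restrict (x : M) :
    Function.Bijective ((orbitDeriv d n G x).rangeRestrict ∘L (transversal d n G x).subtypeL) := by
  constructor
  · refine (injective_iff_map_eq_zero _).2 fun l hl => ?_
    have h1 : (l : EuclideanSpace ℝ (Fin d)) ∈ (orbitDeriv d n G x).ker :=
      congrArg Subtype.val hl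
    exact Subtype.ext ((Submodule.inf_orthogonal_eq_bot (orbitDeriv d n G x).ker).le ⟨h1, l.2⟩)
  · rintro ⟨_, v, rfl⟩
    obtain ⟨y, hy, z, hz, rfl⟩ := Submodule.exists_add_mem_mem_orthogonal
      (K := (orbitDeriv d n G x).ker) v
    refine ⟨⟨z, hz⟩, Subtype.ext ?_⟩
    have hy' : orbitDeriv d n G x y = 0 := hy
    change orbitDeriv d n G x z = orbitDeriv d n G x (y + z)
    rw [map_add, hy', zero_add]

/-- Every group element near the identity moves `x` to the same point as a group element that has
small coordinates in the transversal, because the orbit map has constant rank. -/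
theorem eventually_exists_expChart_smul_eq (x : M) {B : Set (transversal d n G x)} (hB : B ∈ 𝓝 0) :
    ∀ᶠ g in 𝓝 (1 : G), ∃ l ∈ B, expChart d G (oneCoord d G + l) • x = g • x := by
  set T := (orbitDeriv d n G x).range
  have hsurj : Function.Surjective ((T.orthogonalProjectionOnto ∘L
      fderiv ℝ (orbitCoord d n G x) (oneCoord d G)) ∘L (transversal d n G x).subtypeL) := by
    intro t
    obtain ⟨l, hl⟩ := (bijective_orbitDeriv_restrict (d := d) (n := n) (G := G) x).2 t
    refine ⟨l, ?_⟩
    rw [← hl]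
    exact Submodule.orthogonalProjectionOnto_mem_subspace_eq_self (K := T)
      ((orbitDeriv d n G x).rangeRestrict (l : EuclideanSpace ℝ (Fin d)))
  have hcont : ContinuousAt (fun l : transversal d n G x =>
      expChart d G (oneCoord d G + l) • x) 0 := by
    refine ContinuousAt.smul (ContinuousAt.comp (g := expChart d G)
      (f := fun l : transversal d n G x => oneCoord d G + (l : EuclideanSpace ℝ (Fin d))) ?_
      (by fun_prop)) continuousAt_const
    simpa using continuousAt_expChart
  have hB' : B ∩ {l | expChart d G (oneCoord d G + l) • x ∈ (extChartAt (𝓡 n) x).source} ∈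
      𝓝 0 := by
    refine Filter.inter_mem hB (hcont.preimage_mem_nhds ?_)
    simpa [expChart_oneCoord] using extChartAt_source_mem_nhds (I := 𝓡 n) x
  have h1 := eventually_exists_eq_of_finrank_range_le (contDiffAt_orbitCoord (d := d) (n := n)
    (G := G) x) T.orthogonalProjectionOnto (eventually_finrank_range_orbitCoord_le x) _ hsurj hB'
  have h2 : ∀ᶠ g in 𝓝 (1 : G), g • x ∈ (extChartAt (𝓡 n) x).source := by
    refine (continuousAt_id.smul continuousAt_const).preimage_mem_nhds ?_
    change _ ∈ 𝓝 ((1 : G) • x)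
    rw [one_smul]
    exact extChartAt_source_mem_nhds x
  have h1' := (continuousAt_extChartAt (I := 𝓡 d) (1 : G)).eventually h1
  filter_upwards [h1', h2,
    extChartAt_source_mem_nhds (I := 𝓡 d) (1 : G)] with g ⟨l, ⟨hlB, hls⟩, hl⟩ hg hgs
  refine ⟨l, hlB, ?_⟩
  have h3 : expChart d G (extChartAt (𝓡 d) (1 : G) g) = g := (extChartAt (𝓡 d) (1 : G)).left_inv hgs
  rw [orbitCoord, orbitCoord, h3] at hl
  exact (extChartAt (𝓡 n) x).injOn hls hg hl

/-- By compactness of `G`, the orbit of `x` returns close to `x` only through elements that act on `x`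
like elements near `1`. -/
theorem exists_smul_mem_of_mem_nhds_one (x : M) {A : Set G} (hA : A ∈ 𝓝 (1 : G)) :
    ∃ r > 0, ∀ g : G, g • x ∈ Metric.eball x r → ∃ a ∈ A, a • x = g • x := by
  obtain ⟨A', hA'A, hA'o, h1⟩ := mem_nhds_iff.1 hA
  let O : Set G := {g | ∃ a ∈ A', a • x = g • x}
  have hO : IsOpen O := by
    have : O = ⋃ h ∈ MulAction.stabilizer G x, (fun g : G => g * h) ⁻¹' A' := by
      ext g
      simp only [O, mem_ofPred_eq, mem_iUnion, mem_preimage, exists_prop]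
      constructor
      · rintro ⟨a, ha, hax⟩
        refine ⟨g⁻¹ * a, ?_, by simpa using ha⟩
        rw [MulAction.mem_stabilizer_iff, mul_smul, hax, inv_smul_smul]
      · rintro ⟨h, hh, hgh⟩
        exact ⟨g * h, hgh, by rw [mul_smul, MulAction.mem_stabilizer_iff.1 hh]⟩
    rw [this]
    exact isOpen_biUnion fun h _ => hA'o.preimage (continuous_mul_const h)
  have hK : IsClosed ((fun g : G => g • x) '' Oᶜ) :=
    (hO.isClosed_compl.isCompact.image (continuous_id.smul continuous_const)).isClosed
  have hx : x ∉ (fun g : G => g • x) '' Oᶜ := by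
    rintro ⟨g, hg, hgx⟩
    exact hg ⟨1, h1, by simpa using hgx.symm⟩
  obtain ⟨r, hr, hball⟩ := EMetric.mem_nhds_iff.1 (hK.isOpen_compl.mem_nhds hx)
  refine ⟨r, hr, fun g hg => ?_⟩
  have : g ∈ O := by
    by_contra h
    exact hball hg ⟨g, h, rfl⟩
  obtain ⟨a, ha, hax⟩ := this
  exact ⟨a, hA'A ha, hax⟩

/-- Moving a point `y` near `x` along the transversal, exactly one small displacement reaches the
zero set of the equivariant submersion, and it depends continuously on `y`. -/
theorem exists_transversal_displacement (x : M) {ψ : M → EuclideanSpace ℝ (Fin n)}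
    {Q : EuclideanSpace ℝ (Fin n) →L[ℝ] EuclideanSpace ℝ (Fin n)}
    (hψx : ψ x = 0)
    (hrange : ∀ᶠ y in 𝓝 x, ψ y ∈ (orbitDeriv d n G x).range)
    (hψ : HasStrictFDerivAt (ψ ∘ (extChartAt (𝓡 n) x).symm) Q (extChartAt (𝓡 n) x x))
    (hQ : ∀ v, Q (orbitDeriv d n G x v) = orbitDeriv d n G x v) :
    ∃ s : M → transversal d n G x, (∀ᶠ y in 𝓝 x, ContinuousAt s y) ∧ s x = 0 ∧
      ∀ᶠ p : M × transversal d n G x in 𝓝 (x, 0),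
        (ψ (expChart d G (oneCoord d G + p.2) • p.1) = 0 ↔ s p.1 = p.2) := by
  set a := extChartAt (𝓡 n) x x with ha
  set T := (orbitDeriv d n G x).range with hT
  set L := transversal d n G x with hL
  let P := T.orthogonalProjectionOnto
  let Fm : EuclideanSpace ℝ (Fin n) × L → T := fun p =>
    P (ψ ((extChartAt (𝓡 n) x).symm (coordAct n x (expChart d G (oneCoord d G + p.2)) p.1)))
  have hc := (contDiffAt_coordAct_prod (d := d) (n := n) x (1 : G) (by simp)).hasStrictFDerivAt
    one_ne_zero
  simp only [one_mul] at hc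
  set c := fun p : EuclideanSpace ℝ (Fin d) × EuclideanSpace ℝ (Fin n) =>
      coordAct n x (expChart d G p.1) p.2 with hcdef
  have hca : c (oneCoord d G, a) = a := by
    simp only [hcdef]
    rw [expChart_oneCoord, coordAct_self (one_smul _ _)]
  have hc1 : ∀ v, fderiv ℝ c (oneCoord d G, a) (v, 0) = orbitDeriv d n G x v := by
    intro v
    have h1 := HasFDerivAt.comp (f := fun ξ => (ξ, a)) (oneCoord d G) hc.hasFDerivAt
      (hasFDerivAt_prodMk_left (𝕜 := ℝ) (oneCoord d G) a)
    have h2 : c ∘ (fun ξ => (ξ, a)) = orbitCoord d n G x := by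
      ext1 ξ
      simp only [hcdef, Function.comp, coordAct, orbitCoord, ha, extChartAt_to_inv]
    rw [h2] at h1
    rw [orbitDeriv, h1.fderiv]
    rfl
  let j : EuclideanSpace ℝ (Fin n) × L →L[ℝ] EuclideanSpace ℝ (Fin d) × EuclideanSpace ℝ (Fin n) :=
    (L.subtypeL ∘L .snd ℝ _ _).prod (.fst ℝ _ _)
  have hj : HasStrictFDerivAt (fun p : EuclideanSpace ℝ (Fin n) × L =>
      ((oneCoord d G, 0) + j p : EuclideanSpace ℝ (Fin d) × EuclideanSpace ℝ (Fin n))) j (a, 0) :=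
    j.hasStrictFDerivAt.const_add _
  have hj0 : ((oneCoord d G, 0) + j (a, 0) : EuclideanSpace ℝ (Fin d) × EuclideanSpace ℝ (Fin n)) =
      (oneCoord d G, a) := by simp [j]
  have hF : HasStrictFDerivAt Fm (P ∘L Q ∘L fderiv ℝ c (oneCoord d G, a) ∘L j) (a, 0) := by
    rw [← hj0] at hc
    have h1 := hc.comp (f := fun p : EuclideanSpace ℝ (Fin n) × L =>
      ((oneCoord d G, 0) + j p : EuclideanSpace ℝ (Fin d) × EuclideanSpace ℝ (Fin n))) (a, 0) hj
    have h2 : c ((oneCoord d G, 0) + j (a, 0)) = a := by rw [hj0, hca]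
    rw [← h2] at hψ
    have h3 := P.hasStrictFDerivAt.comp (a, (0 : L)) (HasStrictFDerivAt.comp
      (f := c ∘ fun p : EuclideanSpace ℝ (Fin n) × L =>
      ((oneCoord d G, 0) + j p : EuclideanSpace ℝ (Fin d) × EuclideanSpace ℝ (Fin n)))
      (a, (0 : L)) hψ h1)
    rw [hj0] at h3
    refine h3.congr_of_eventuallyEq (Filter.Eventually.of_forall fun p => ?_)
    simp [Fm, j, hcdef]
  -- the partial derivative along the transversal is the restriction of the orbit map
  have hinv : ((P ∘L Q ∘L fderiv ℝ c (oneCoord d G, a) ∘L j) ∘L .inr ℝ _ L).IsInvertible := by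
    refine ⟨(LinearEquiv.ofBijective _
      (bijective_orbitDeriv_restrict (d := d) (n := n) (G := G) x)).toContinuousLinearEquiv, ?_⟩
    ext1 l
    change (orbitDeriv d n G x).rangeRestrict (l : EuclideanSpace ℝ (Fin d)) =
      P (Q (fderiv ℝ c (oneCoord d G, a) (l, 0)))
    rw [hc1, hQ]
    exact (Submodule.orthogonalProjectionOnto_mem_subspace_eq_self (K := T)
      ((orbitDeriv d n G x).rangeRestrict (l : EuclideanSpace ℝ (Fin d)))).symm
  have hF0 : Fm (a, 0) = 0 := by
    simp [Fm, expChart_oneCoord, coordAct, ha, hψx]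
  set σ := hF.implicitFunctionOfProdDomain hinv with hσ
  have hiff := hF.eventually_apply_eq_iff_implicitFunctionOfProdDomain hinv
  rw [hF0] at hiff
  obtain ⟨K, Z, hZ, hlip⟩ :=
    (hF.hasStrictFDerivAt_implicitFunctionOfProdDomain hinv).exists_lipschitzOnWith
  refine ⟨fun y => σ (extChartAt (𝓡 n) x y), ?_, ?_, ?_⟩
  · filter_upwards [(continuousAt_extChartAt (I := 𝓡 n) x).eventually (eventually_mem_nhds_iff.2 hZ),
      extChartAt_source_mem_nhds (I := 𝓡 n) x] with y hy hys
    exact (hlip.continuousOn.continuousAt hy).comp (continuousAt_extChartAt' hys)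
  · exact hiff.self_of_nhds.1 hF0
  · have h1 : Filter.Tendsto (fun p : M × L => (extChartAt (𝓡 n) x p.1, p.2)) (𝓝 (x, 0))
        (𝓝 (a, 0)) :=
      ((continuousAt_extChartAt x).comp (x := (x, (0 : L))) continuousAt_fst).prodMk continuousAt_snd
    have h2 : ContinuousAt (fun p : M × L =>
        expChart d G (oneCoord d G + (p.2 : EuclideanSpace ℝ (Fin d))) • p.1) (x, 0) := by
      refine ContinuousAt.smul (ContinuousAt.comp (g := expChart d G)
        (f := fun p : M × L => oneCoord d G + (p.2 : EuclideanSpace ℝ (Fin d))) ?_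
        (by fun_prop)) continuousAt_fst
      simpa using continuousAt_expChart
    have h2' : Filter.Tendsto (fun p : M × L =>
        expChart d G (oneCoord d G + (p.2 : EuclideanSpace ℝ (Fin d))) • p.1) (𝓝 (x, 0)) (𝓝 x) := by
      simpa [ContinuousAt, expChart_oneCoord] using h2
    filter_upwards [h1.eventually hiff, h2'.eventually hrange,
      h2'.eventually (extChartAt_source_mem_nhds (I := 𝓡 n) x),
      continuousAt_fst.eventually (extChartAt_source_mem_nhds (I := 𝓡 n) x)] with p h3 h4 h5 h6
    rw [← h3]
    simp only [Fm, coordAct]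
    rw [(extChartAt (𝓡 n) x).left_inv h6, (extChartAt (𝓡 n) x).left_inv h5]
    constructor
    · intro h
      rw [h, map_zero]
    · intro h
      have h7 := Submodule.orthogonalProjectionOnto_mem_subspace_eq_self (K := T) ⟨_, h4⟩
      exact congrArg Subtype.val (h7.symm.trans h)

/-- The zero set of the equivariant submersion in a small ball around `x` is a slice at `x`. An
element `g` that maps a point of it into it acts on `x` like a small element `κ` of the transversal;
then `κ⁻¹ * g` fixes `x`, and `κ` moves a point of the zero set within the zero set, so that
`κ = 1` by uniqueness of the displacement. Sliding points into the zero set along the transversal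
is a continuous local section of the action map, which is therefore open. -/
theorem hasSmallSlices (d n : ℕ) [ChartedSpace (EuclideanSpace ℝ (Fin d)) G]
    [LieGroup (𝓡 d) ∞ G] [ChartedSpace (EuclideanSpace ℝ (Fin n)) M] [IsManifold (𝓡 n) ∞ M]
    [ContMDiffSMul (𝓡 d) (𝓡 n) ∞ G M] : HasSmallSlices G M := by
  intro x U hU
  obtain ⟨r₀, ψ, Q, hr₀, hsrc, hψx, hequiv, hrange, hψ, hQ⟩ :=
    exists_equivariant_submersion (d := d) (n := n) (G := G) x
  obtain ⟨s, hsc, hsx, hs⟩ := exists_transversal_displacement (d := d) (G := G) x hψx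
    (Filter.mem_of_superset (Metric.eball_mem_nhds x hr₀) hrange) hψ hQ
  rw [nhds_prod_eq] at hs
  obtain ⟨Y, hY, B, hB, hYB⟩ := Filter.mem_prod_iff.1 hs
  have hYB : ∀ y ∈ Y, ∀ l ∈ B,
      (ψ (expChart d G (oneCoord d G + l) • y) = 0 ↔ s y = l) := fun y hy l hl =>
    hYB (mk_mem_prod hy hl)
  obtain ⟨r₁, hr₁, hA⟩ := exists_smul_mem_of_mem_nhds_one x
    (eventually_exists_expChart_smul_eq (d := d) (n := n) x hB)
  obtain ⟨r₂, hr₂, hball⟩ := EMetric.mem_nhds_iff.1 (Filter.inter_mem hU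
    (Filter.inter_mem hY (hsc : {y | ContinuousAt s y} ∈ 𝓝 x)))
  set r := min (r₁ / 2) (min r₂ r₀) with hr
  have hrpos : 0 < r := lt_min (ENNReal.half_pos hr₁.ne') (lt_min hr₂ hr₀)
  have hB0 : (0 : transversal d n G x) ∈ B := mem_of_mem_nhds hB
  have hr' : Metric.eball x r ⊆ Metric.eball x r₂ ∩ Metric.eball x r₀ := fun y hy =>
    ⟨Metric.eball_subset_eball ((min_le_right _ _).trans (min_le_left _ _)) hy,
      Metric.eball_subset_eball ((min_le_right _ _).trans (min_le_right _ _)) hy⟩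
  have hsmul : ∀ h : G, h • x = x → ∀ y ∈ Metric.eball x r, h • y ∈ Metric.eball x r := by
    intro h hh y hy
    rw [Metric.mem_eball] at hy ⊢
    rwa [← hh, edist_smul_left]
  set S : Set M := {y | y ∈ Metric.eball x r ∧ ψ y = 0} with hS
  have hSinv : ∀ h : G, h • x = x → ∀ y ∈ S, h • y ∈ S := fun h hh y hy =>
    ⟨hsmul h hh y hy.1, by rw [hequiv h hh y (hr' hy.1).2, hy.2, map_zero]⟩
  have hone : expChart d G (oneCoord d G + ((0 : transversal d n G x) : _)) = 1 := by
    simp [expChart_oneCoord]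
  have hs0 : ∀ y ∈ S, s y = 0 := fun y hy => by
    rw [← hYB y (hball (hr' hy.1).1).2.1 0 hB0, hone, one_smul]
    exact hy.2
  refine ⟨S, fun y hy => (hball (hr' hy.1).1).1, ⟨Metric.mem_eball_self hrpos, hψx⟩, hSinv, ?_, ?_⟩
  · intro g y hy hgy
    -- `g` moves `x` as little as `y`, so `g • x = κ(l) • x` with `l` small
    have hgx : g • x ∈ Metric.eball x r₁ := by
      rw [Metric.mem_eball]
      calc edist (g • x) x ≤ edist (g • x) (g • y) + edist (g • y) x := edist_triangle _ _ _
        _ < r + r := ENNReal.add_lt_add (by rw [edist_smul_left, edist_comm]; exact hy.1) hgy.1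
        _ ≤ r₁ / 2 + r₁ / 2 := add_le_add (min_le_left _ _) (min_le_left _ _)
        _ = r₁ := ENNReal.add_halves r₁
    obtain ⟨k, ⟨l, hl, hlk⟩, hk⟩ := hA g hgx
    set κ := expChart d G (oneCoord d G + l)
    have hgκ : κ⁻¹ * g ∈ MulAction.stabilizer G x := by
      rw [MulAction.mem_stabilizer_iff, mul_smul, inv_smul_eq_iff, hlk, hk]
    have hz := hSinv _ hgκ y hy
    have h1 : ψ (κ • (κ⁻¹ * g) • y) = 0 := by
      rw [smul_smul, mul_inv_cancel_left]
      exact hgy.2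
    have h2 := (hYB _ (hball (hr' hz.1).1).2.1 l hl).1 h1
    rw [hs0 _ hz] at h2
    have h3 : κ = 1 := by
      simp only [κ]
      rw [← h2, hone]
    rwa [h3, inv_one, one_mul] at hgκ
  · refine isOpenMap_iff_nhds_le.2 ?_
    rintro ⟨g, y, hy⟩ O hO
    obtain ⟨A, hAg, B', hB', hAB⟩ := mem_nhds_prod_iff.1 (Filter.mem_map.1 hO)
    obtain ⟨B'', hB'', hBB⟩ := mem_nhds_subtype _ _ _ |>.1 hB'
    have hyb := hball (hr' hy.1).1
    -- slide a point `z` near `y` along the transversal into the slice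
    have hscy : ContinuousAt (fun z => expChart d G (oneCoord d G + (s z : _))) y := by
      refine ContinuousAt.comp (g := expChart d G)
        (f := fun z => oneCoord d G + (s z : EuclideanSpace ℝ (Fin d))) ?_
        (continuousAt_const.add (continuous_subtype_val.continuousAt.comp hyb.2.2))
      rw [hs0 y hy]
      simpa using continuousAt_expChart
    have hq : Filter.Tendsto (fun z => expChart d G (oneCoord d G + (s z : _)) • z) (𝓝 y) (𝓝 y) := by
      have h := hscy.smul (continuousAt_id (x := y))
      simpa [ContinuousAt, hs0 y hy, expChart_oneCoord, Pi.smul_def'] using h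
    have hg' : Filter.Tendsto (fun z => g * (expChart d G (oneCoord d G + (s z : _)))⁻¹) (𝓝 y)
        (𝓝 g) := by
      have h := hscy.inv.const_mul g
      simpa [ContinuousAt, hs0 y hy, expChart_oneCoord] using h
    have hsB : ∀ᶠ z in 𝓝 y, s z ∈ B := by
      have h : Filter.Tendsto s (𝓝 y) (𝓝 0) := by simpa [ContinuousAt, hs0 y hy] using hyb.2.2
      exact h hB
    have hyr : Metric.eball x r ∈ 𝓝 y := Metric.isOpen_eball.mem_nhds hy.1
    have key : ∀ᶠ z in 𝓝 y, g • z ∈ O := by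
      filter_upwards [hq.eventually hB'', hg'.eventually hAg, hsB, hyr, hq.eventually hyr]
        with z h1 h2 h3 h4 h5
      have h6 := (hYB z (hball (hr' h4).1).2.1 (s z) h3).2 rfl
      have h7 : (⟨_, ⟨h5, h6⟩⟩ : S) ∈ B' := hBB h1
      have h8 := hAB (mk_mem_prod h2 h7)
      simp only [mem_preimage, smul_smul, inv_mul_cancel_right] at h8
      exact h8
    have h9 := (continuous_const_smul g⁻¹).tendsto (g • y)
    rw [inv_smul_smul] at h9
    filter_upwards [h9.eventually key] with z hz
    simpa using hz

end SliceTheorem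

/-! ### Hausdorff dimension in charts -/

/-- A map that is Lipschitz at each point of `D`, with no uniformity, does not raise the Hausdorff
dimension of `D`: it is locally Lipschitz on countably many pieces that exhaust `D`. -/
theorem dimH_image_le_of_pointwise_lipschitz {X Y : Type*} [EMetricSpace X]
    [SecondCountableTopology X] [EMetricSpace Y] {u : X → Y} {D : Set X}
    (h : ∀ z ∈ D, ∃ C : NNReal, ∀ᶠ w in 𝓝 z, edist (u z) (u w) ≤ C * edist z w) :
    dimH (u '' D) ≤ dimH D := by
  let P : ℕ → Set X := fun m =>
    {z ∈ D | ∀ w, edist w z < (m : ℝ≥0∞)⁻¹ → edist (u z) (u w) ≤ m * edist z w}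
  have hcov : D ⊆ ⋃ m, P m := by
    intro z hz
    obtain ⟨C, hC⟩ := h z hz
    obtain ⟨ε, hε, hball⟩ := EMetric.mem_nhds_iff.1 hC
    obtain ⟨m₁, hm₁⟩ := ENNReal.exists_inv_nat_lt hε.ne'
    obtain ⟨m₂, hm₂⟩ := exists_nat_ge C
    refine mem_iUnion.2 ⟨max m₁ m₂, hz, fun w hw => ?_⟩
    have h1 : edist w z < ε := hw.trans_le (le_trans (ENNReal.inv_le_inv.2
      (by exact_mod_cast le_max_left m₁ m₂)) hm₁.le)
    refine (hball h1 : edist (u z) (u w) ≤ C * edist z w).trans ?_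
    gcongr
    exact_mod_cast hm₂.trans (by exact_mod_cast le_max_right m₁ m₂)
  refine (dimH_mono (image_mono hcov)).trans ?_
  rw [image_iUnion, dimH_iUnion]
  refine iSup_le fun m => le_trans ?_ (dimH_mono (sep_subset D _ : P m ⊆ D))
  refine dimH_image_le_of_locally_lipschitzOn fun z hz =>
    ⟨m, P m ∩ Metric.eball z ((m : ℝ≥0∞)⁻¹ / 2), ?_, ?_⟩
  · refine Filter.inter_mem self_mem_nhdsWithin (mem_nhdsWithin_of_mem_nhds ?_)
    exact Metric.eball_mem_nhds _ (ENNReal.half_pos (by simp))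
  · rintro y ⟨hy, hyz⟩ w ⟨-, hwz⟩
    refine hy.2 w ((edist_triangle_right w y z).trans_lt ?_)
    rw [← ENNReal.add_halves (m : ℝ≥0∞)⁻¹]
    exact ENNReal.add_lt_add hwz hyz

section Chart

variable {n : ℕ} {M : Type*} [EMetricSpace M]
  [ChartedSpace (EuclideanSpace ℝ (Fin n)) M] [IsManifold (𝓡 n) ∞ M]
  [RiemannianBundle (fun x : M => TangentSpace (𝓡 n) x)]
  [IsContMDiffRiemannianBundle (𝓡 n) ∞ (EuclideanSpace ℝ (Fin n))
    (fun x : M => TangentSpace (𝓡 n) x)]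
  [IsRiemannianManifold (𝓡 n) M]

theorem eventually_edist_extChartAt_symm_le (x : M) {z : EuclideanSpace ℝ (Fin n)}
    (hz : z ∈ (extChartAt (𝓡 n) x).target) :
    ∃ C : NNReal, ∀ᶠ w in 𝓝 z, edist ((extChartAt (𝓡 n) x).symm z)
      ((extChartAt (𝓡 n) x).symm w) ≤ C * edist z w := by
  have : IsContinuousRiemannianBundle (EuclideanSpace ℝ (Fin n))
    (fun x : M => TangentSpace (𝓡 n) x) := by
    obtain ⟨g, hg, h⟩ := IsContMDiffRiemannianBundle.exists_contMDiff (IB := 𝓡 n) (n := ∞)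
      (F := EuclideanSpace ℝ (Fin n)) (E := fun x : M => TangentSpace (𝓡 n) x)
    exact ⟨g, hg.continuous, h⟩
  set u := (extChartAt (𝓡 n) x).symm with hu
  obtain ⟨C, -, hC⟩ := eventually_riemannianEDist_le_edist_extChartAt (𝓡 n) (u z)
  have hcont : ContinuousAt u z := continuousAt_extChartAt_symm'' hz
  have hchange : ContDiffAt ℝ 1 (extChartAt (𝓡 n) (u z) ∘ u) z := by
    have h1 : ContMDiffAt 𝓘(ℝ, EuclideanSpace ℝ (Fin n)) (𝓡 n) 1 u z :=
      (contMDiffOn_extChartAt_symm x).contMDiffAt (extChartAt_target_mem_nhds' hz)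
    exact (ContMDiffAt.comp z (contMDiffAt_extChartAt (x := u z)) h1).contDiffAt
  obtain ⟨K, t, ht, hlip⟩ := hchange.exists_lipschitzOnWith
  refine ⟨C * K, ?_⟩
  filter_upwards [hcont.eventually hC, ht] with w hw hwt
  rw [IsRiemannianManifold.out (I := 𝓡 n)]
  refine hw.trans ?_
  rw [ENNReal.coe_mul, mul_assoc]
  gcongr
  exact hlip (mem_of_mem_nhds ht) hwt

theorem dimH_extChartAt_symm_image_le (x : M) {D : Set (EuclideanSpace ℝ (Fin n))}
    (hD : D ⊆ (extChartAt (𝓡 n) x).target) :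
    dimH ((extChartAt (𝓡 n) x).symm '' D) ≤ dimH D :=
  dimH_image_le_of_pointwise_lipschitz fun _ hz => eventually_edist_extChartAt_symm_le x (hD hz)

end Chart

/-! ### Orbits -/

section Orbits

variable {d n : ℕ} {G : Type*} [Group G] [TopologicalSpace G] [IsTopologicalGroup G]
  [ChartedSpace (EuclideanSpace ℝ (Fin d)) G] [LieGroup (𝓡 d) ∞ G]
  {M : Type*} [EMetricSpace M]
  [ChartedSpace (EuclideanSpace ℝ (Fin n)) M] [IsManifold (𝓡 n) ∞ M]
  [MulAction G M] [ContMDiffSMul (𝓡 d) (𝓡 n) ∞ G M] [ContinuousSMul G M]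
  [CompactSpace G] [T2Space G] [IsIsometricSMul G M]

theorem mfderiv_orbit_eq (x : M) :
    ∀ Y : EuclideanSpace ℝ (Fin d),
      mfderiv (𝓡 d) (𝓡 n) (fun g : G => g • x) (1 : G) Y = orbitDeriv d n G x Y := by
  intro Y
  have h : MDifferentiableAt (𝓡 d) (𝓡 n) (fun g : G => g • x) (1 : G) :=
    (ContMDiffAt.smul (I := 𝓡 d) (I' := 𝓡 n) (n := 1) contMDiffAt_id
      contMDiffAt_const).mdifferentiableAt one_ne_zero
  have h1 : mfderiv (𝓡 d) (𝓡 n) (fun g : G => g • x) (1 : G) =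
      fderivWithin ℝ (writtenInExtChartAt (𝓡 d) (𝓡 n) (1 : G) fun g : G => g • x)
        (range (𝓡 d)) (extChartAt (𝓡 d) (1 : G) 1) := if_pos h
  rw [h1, ModelWithCorners.range_eq_univ, fderivWithin_univ]
  have h2 : writtenInExtChartAt (𝓡 d) (𝓡 n) (1 : G) (fun g : G => g • x) = orbitCoord d n G x := by
    simp only [writtenInExtChartAt, one_smul]
    rfl
  rw [h2]
  rfl

theorem mem_discreteSlicePoints_iff (x : M) :
    x ∈ discreteSlicePoints G d n M ↔ (orbitDeriv d n G x).range = ⊤ := by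
  constructor
  · intro h
    by_contra hne
    obtain ⟨f, hf, hle⟩ := Submodule.exists_le_ker_of_lt_top _ (lt_top_iff_ne_top.2 hne)
    refine hf ?_
    have h1 : (f.toContinuousLinearMap : EuclideanSpace ℝ (Fin n) →L[ℝ] ℝ) ∈
        transverseCotangent G d n x := fun Y =>
      (congrArg f (mfderiv_orbit_eq x Y)).trans (hle ⟨Y, rfl⟩)
    have h2 : transverseCotangent G d n x = {0} := h
    rw [h2] at h1
    ext1 v
    exact congrArg (fun φ : EuclideanSpace ℝ (Fin n) →L[ℝ] ℝ => φ v) h1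
  · intro h
    refine Set.eq_singleton_iff_unique_mem.2 ⟨fun Y => rfl, fun φ hφ => ?_⟩
    refine ContinuousLinearMap.ext fun v => ?_
    obtain ⟨Y, hY⟩ : (v : EuclideanSpace ℝ (Fin n)) ∈ (orbitDeriv d n G x).range := h ▸ trivial
    have h1 := hφ Y
    rw [mfderiv_orbit_eq x Y] at h1
    rw [← hY]
    exact h1

theorem orbit_mem_nhds_of_range_eq_top (x : M) (h : (orbitDeriv d n G x).range = ⊤) :
    MulAction.orbit G x ∈ 𝓝 x := by
  have h1 := ((contDiffAt_orbitCoord (d := d) (n := n) (G := G) x).hasStrictFDerivAt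
    one_ne_zero).map_nhds_eq_of_surj h
  rw [orbitCoord_oneCoord] at h1
  have h2 : ∀ᶠ ξ in 𝓝 (oneCoord d G), expChart d G ξ • x ∈ (extChartAt (𝓡 n) x).source := by
    refine (continuousAt_expChart.smul continuousAt_const).preimage_mem_nhds ?_
    change _ ∈ 𝓝 (expChart d G (oneCoord d G) • x)
    rw [expChart_oneCoord, one_smul]
    exact extChartAt_source_mem_nhds x
  have h3 := Filter.image_mem_map (m := orbitCoord d n G x) h2
  rw [h1] at h3
  filter_upwards [(continuousAt_extChartAt (I := 𝓡 n) x).preimage_mem_nhds h3,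
    extChartAt_source_mem_nhds (I := 𝓡 n) x] with y ⟨ξ, hξ, hy⟩ hys
  exact ⟨expChart d G ξ, (extChartAt (𝓡 n) x).injOn hξ hys hy⟩

/-- If the tangent space of the orbit is not everything, then near `x` the orbit is in coordinates
the image of a disc of dimension less than `n`. -/
theorem exists_dimH_lt_of_range_ne_top (x : M) (h : (orbitDeriv d n G x).range ≠ ⊤)
    {Z : Set (EuclideanSpace ℝ (Fin n))} (hZ : Z ∈ 𝓝 (extChartAt (𝓡 n) x x)) :
    ∃ A ∈ 𝓝 (1 : G), ∃ D ⊆ Z, dimH D < n ∧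
      ∀ g ∈ A, g • x ∈ (extChartAt (𝓡 n) x).source ∧ extChartAt (𝓡 n) x (g • x) ∈ D := by
  set L := transversal d n G x
  have hdim : Module.finrank ℝ L < n := by
    have h1 : Module.finrank ℝ L = Module.finrank ℝ (orbitDeriv d n G x).range :=
      (LinearEquiv.ofBijective _
        (bijective_orbitDeriv_restrict (d := d) (n := n) (G := G) x)).finrank_eq
    rw [h1]
    exact (Submodule.finrank_lt h).trans_eq finrank_euclideanSpace_fin
  let f : L → EuclideanSpace ℝ (Fin d) := fun l => oneCoord d G + l
  have hf : ContDiff ℝ 1 f := contDiff_const.add L.subtypeL.contDiff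
  have hf0 : f 0 = oneCoord d G := by simp [f]
  have hΨ : ContDiffAt ℝ 1 (orbitCoord d n G x ∘ f) 0 := by
    refine ContDiffAt.comp 0 ?_ hf.contDiffAt
    rw [hf0]
    exact contDiffAt_orbitCoord x
  obtain ⟨K, t, ht, hlip⟩ := hΨ.exists_lipschitzOnWith
  have hΨ0 : (orbitCoord d n G x ∘ f) 0 = extChartAt (𝓡 n) x x := by
    rw [Function.comp_apply, hf0, orbitCoord_oneCoord]
  have hB : t ∩ (orbitCoord d n G x ∘ f) ⁻¹' Z ∈ 𝓝 0 :=
    Filter.inter_mem ht (hΨ.continuousAt.preimage_mem_nhds (by rwa [hΨ0]))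
  have h2 : ∀ᶠ g in 𝓝 (1 : G), g • x ∈ (extChartAt (𝓡 n) x).source := by
    refine (continuousAt_id.smul continuousAt_const).preimage_mem_nhds ?_
    change _ ∈ 𝓝 ((1 : G) • x)
    rw [one_smul]
    exact extChartAt_source_mem_nhds x
  refine ⟨_, Filter.inter_mem h2 (eventually_exists_expChart_smul_eq (d := d) (n := n) x hB),
    (orbitCoord d n G x ∘ f) '' (t ∩ (orbitCoord d n G x ∘ f) ⁻¹' Z), ?_, ?_, ?_⟩
  · rintro _ ⟨l, hl, rfl⟩
    exact hl.2
  · refine ((hlip.mono inter_subset_left).dimH_image_le).trans_lt ?_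
    refine (dimH_mono (subset_univ _)).trans_lt ?_
    rw [Real.dimH_univ_eq_finrank L]
    exact_mod_cast hdim
  · rintro g ⟨hg, l, hl, hlg⟩
    exact ⟨hg, l, hl, congrArg (extChartAt (𝓡 n) x) hlg⟩

end Orbits

/-! ### Open orbits and null orbits -/

section OpenOrbits

variable {d n : ℕ} {G : Type*} [Group G] [TopologicalSpace G] [IsTopologicalGroup G]
  [ChartedSpace (EuclideanSpace ℝ (Fin d)) G] [LieGroup (𝓡 d) ∞ G]
  {M : Type*} [EMetricSpace M]
  [ChartedSpace (EuclideanSpace ℝ (Fin n)) M] [IsManifold (𝓡 n) ∞ M]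
  [MulAction G M] [ContMDiffSMul (𝓡 d) (𝓡 n) ∞ G M] [ContinuousSMul G M]
  [CompactSpace G] [T2Space G] [IsIsometricSMul G M]

/-- An orbit that is a neighbourhood of `x` has full dimension, whereas the coordinate image of the
part near `x` of an orbit with smaller tangent space has dimension less than `n`. -/
theorem mem_discreteSlicePoints_iff_orbit_mem_nhds (x : M) :
    x ∈ discreteSlicePoints G d n M ↔ MulAction.orbit G x ∈ 𝓝 x := by
  rw [mem_discreteSlicePoints_iff]
  refine ⟨orbit_mem_nhds_of_range_eq_top x, fun h => ?_⟩
  by_contra hne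
  obtain ⟨A, hA, D, -, hdim, hAD⟩ := exists_dimH_lt_of_range_ne_top x hne Filter.univ_mem
  obtain ⟨r, hr, hrA⟩ := exists_smul_mem_of_mem_nhds_one x hA
  have h1 : MulAction.orbit G x ∩ Metric.eball x r ∈ 𝓝 x :=
    Filter.inter_mem h (Metric.eball_mem_nhds x hr)
  have h2 : D ∈ 𝓝 (extChartAt (𝓡 n) x x) := by
    filter_upwards [extChartAt_image_nhds_mem_nhds_of_boundaryless (I := 𝓡 n) h1]
    rintro _ ⟨_, ⟨⟨g, rfl⟩, hg⟩, rfl⟩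
    obtain ⟨a, ha, hag⟩ := hrA g hg
    change extChartAt (𝓡 n) x (g • x) ∈ D
    rw [← hag]
    exact (hAD a ha).2
  rw [Real.dimH_of_mem_nhds h2, finrank_euclideanSpace_fin] at hdim
  exact lt_irrefl _ hdim

theorem smul_mem_discreteSlicePoints (g : G) {x : M} (hx : x ∈ discreteSlicePoints G d n M) :
    g • x ∈ discreteSlicePoints G d n M := by
  rw [mem_discreteSlicePoints_iff_orbit_mem_nhds] at hx ⊢
  rw [MulAction.orbit_smul]
  have h1 := (Homeomorph.smul g).isOpenMap.image_mem_nhds hx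
  filter_upwards [h1]
  rintro _ ⟨_, ⟨k, rfl⟩, rfl⟩
  exact ⟨g * k, mul_smul g k x⟩

/-- A point of a connected neighbourhood that has an open orbit has an orbit that contains the
neighbourhood, because orbits are closed. -/
theorem isClosed_discreteSlicePoints : IsClosed (discreteSlicePoints G d n M) := by
  have : LocallyConnectedSpace M :=
    ChartedSpace.locallyConnectedSpace (EuclideanSpace ℝ (Fin n)) M
  refine isClosed_of_closure_subset fun x hx => ?_
  obtain ⟨B, ⟨hB, hxB, hconn⟩, -⟩ := (LocallyConnectedSpace.open_connected_basis x).mem_iff.1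
    Filter.univ_mem
  obtain ⟨y, hyB, hy⟩ := mem_closure_iff.1 hx B hB hxB
  have hopen : IsOpen (MulAction.orbit G y) := isOpen_iff_mem_nhds.2 fun z hz => by
    obtain ⟨g, rfl⟩ := hz
    have h1 := (mem_discreteSlicePoints_iff_orbit_mem_nhds (d := d) (n := n) (g • y)).1
      (smul_mem_discreteSlicePoints g hy)
    rwa [MulAction.orbit_smul] at h1
  have hclosed : IsClosed (MulAction.orbit G y) :=
    (isCompact_range (continuous_id.smul continuous_const)).isClosed
  obtain ⟨g, rfl⟩ := hconn.isPreconnected.subset_isClopen ⟨hclosed, hopen⟩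
    ⟨y, hyB, MulAction.mem_orbit_self y⟩ hxB
  exact smul_mem_discreteSlicePoints g hy

variable [RiemannianBundle (fun x : M => TangentSpace (𝓡 n) x)]
  [IsContMDiffRiemannianBundle (𝓡 n) ∞ (EuclideanSpace ℝ (Fin n))
    (fun x : M => TangentSpace (𝓡 n) x)]
  [IsRiemannianManifold (𝓡 n) M]

theorem dimH_orbit_lt {x : M} (hx : x ∉ discreteSlicePoints G d n M) :
    dimH (MulAction.orbit G x) < n := by
  rw [mem_discreteSlicePoints_iff] at hx
  obtain ⟨A, hA, D, hD, hdim, hAD⟩ := exists_dimH_lt_of_range_ne_top x hx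
    (extChartAt_target_mem_nhds (I := 𝓡 n) x)
  let Q : Set M := (extChartAt (𝓡 n) x).symm '' D
  have hQ : dimH Q ≤ dimH D := dimH_extChartAt_symm_image_le x hD
  -- finitely many translates of the piece `A • x` cover the orbit
  obtain ⟨t, -, ht⟩ := isCompact_univ.elim_nhds_subcover (fun g : G => (g⁻¹ * ·) ⁻¹' A) fun g _ =>
    (continuous_const_mul g⁻¹).continuousAt.preimage_mem_nhds (by simpa using hA)
  have hcov : MulAction.orbit G x ⊆ ⋃ g ∈ (t : Set G), (g • · : M → M) '' Q := by
    rintro _ ⟨k, rfl⟩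
    obtain ⟨g, hg, hk⟩ := mem_iUnion₂.1 (ht (mem_univ k))
    have hk : g⁻¹ * k ∈ A := hk
    obtain ⟨h1, h2⟩ := hAD _ hk
    refine mem_iUnion₂.2 ⟨g, hg, (g⁻¹ * k) • x, ⟨_, h2, (extChartAt (𝓡 n) x).left_inv h1⟩, ?_⟩
    change g • (g⁻¹ * k) • x = k • x
    rw [smul_smul, mul_inv_cancel_left]
  refine ((dimH_mono hcov).trans ?_).trans_lt hdim
  rw [dimH_bUnion t.countable_toSet]
  exact iSup₂_le fun g _ => ((isometry_smul M g).dimH_image Q).le.trans hQ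

variable [MeasurableSpace M] [BorelSpace M]

/-- The closed orbit of `x` is the intersection of its tubular neighbourhoods of radius
`1 / (k + 1)`, and it is a null set when it is not open. -/
theorem exists_seq_invariant_nhds_measure_iInter_eq_zero {x : M}
    (hx : x ∉ discreteSlicePoints G d n M) :
    ∃ U : ℕ → Set M, (∀ k, IsOpen (U k)) ∧ (∀ k, x ∈ U k) ∧
      (∀ k (g : G), ∀ y ∈ U k, g • y ∈ U k) ∧
      (Measure.euclideanHausdorffMeasure n : Measure M) (⋂ k, U k) = 0 := by
  refine ⟨fun k => {z | ∃ g : G, edist (g • z) x < ((k + 1 : ℕ) : ℝ≥0∞)⁻¹}, fun k => ?_,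
    fun k => ⟨1, by simp⟩, ?_, ?_⟩
  · simp only [ofPred_exists]
    exact isOpen_iUnion fun g => isOpen_lt ((continuous_const_smul g).edist continuous_const)
      continuous_const
  · rintro k g y ⟨h, hy⟩
    exact ⟨h * g⁻¹, by rwa [smul_smul, inv_mul_cancel_right]⟩
  · have hclosed : IsClosed (MulAction.orbit G x) :=
      (isCompact_range (continuous_id.smul continuous_const)).isClosed
    have hsub : (⋂ k : ℕ, {z : M | ∃ g : G, edist (g • z) x < ((k + 1 : ℕ) : ℝ≥0∞)⁻¹}) ⊆
        MulAction.orbit G x := by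
      intro z hz
      rw [← hclosed.closure_eq]
      refine EMetric.mem_closure_iff.2 fun ε hε => ?_
      obtain ⟨k, hk⟩ := ENNReal.exists_inv_nat_lt hε.ne'
      obtain ⟨g, hg⟩ := mem_iInter.1 hz k
      refine ⟨g⁻¹ • x, ⟨g⁻¹, rfl⟩, ?_⟩
      rw [← edist_smul_left g, smul_inv_smul]
      exact hg.trans_le (le_trans (ENNReal.inv_le_inv.2 (by exact_mod_cast k.le_succ)) hk.le)
    refine measure_mono_null hsub ?_
    have h1 : Measure.hausdorffMeasure (n : ℝ) (MulAction.orbit G x) = 0 := by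
      exact_mod_cast hausdorffMeasure_of_dimH_lt (d := (n : NNReal))
        (by exact_mod_cast dimH_orbit_lt hx)
    rw [Measure.euclideanHausdorffMeasure_def, Measure.smul_apply, h1, smul_zero]

end OpenOrbits

end EquivL2

end

theorem mainTheorem7
    {d n : ℕ}
    -- a compact Lie group
    {G : Type*} [Group G] [TopologicalSpace G] [T2Space G] [CompactSpace G]
    [ChartedSpace (EuclideanSpace ℝ (Fin d)) G] [LieGroup (𝓡 d) ∞ G]
    -- a closed Riemannian manifold
    {M : Type*} [EMetricSpace M] [CompactSpace M]
    [ChartedSpace (EuclideanSpace ℝ (Fin n)) M] [IsManifold (𝓡 n) ∞ M]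
    [RiemannianBundle (fun x : M => TangentSpace (𝓡 n) x)]
    [IsContMDiffRiemannianBundle (𝓡 n) ∞ (EuclideanSpace ℝ (Fin n))
      (fun x : M => TangentSpace (𝓡 n) x)]
    [IsRiemannianManifold (𝓡 n) M] [MeasurableSpace M] [BorelSpace M]
    -- a smooth action by isometries
    [MulAction G M] [ContMDiffSMul (𝓡 d) (𝓡 n) ∞ G M] [IsIsometricSMul G M]
    -- a Hermitian vector bundle with an action of `G`
    {F : Type*} [NormedAddCommGroup F] [NormedSpace ℂ F] [FiniteDimensional ℂ F]
    {V : M → Type*} [∀ x, NormedAddCommGroup (V x)] [∀ x, InnerProductSpace ℂ (V x)]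
    [TopologicalSpace (TotalSpace F V)] [FiberBundle F V] [VectorBundle ℂ F V]
    [EquivL2.IsHermitianBundle F V] (ρ : EquivL2.BundleAction G F V)
    -- an irreducible unitary representation
    {A : Type*} [NormedAddCommGroup A] [InnerProductSpace ℂ A] [CompleteSpace A]
    (α : Representation ℂ G A) (hα : EquivL2.IsIrreducibleUnitary α)
    -- the Riemannian volume
    (μ : Measure M) (hμ : μ = Measure.euclideanHausdorffMeasure n)
    -- the complement of the two exceptional sets
    (S : Set M) (hS : S = (EquivL2.discreteSlicePoints G d n M ∪ EquivL2.nullSet μ ρ α)ᶜ) :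
    -- `Φ f` is the multiplication operator `M_f`
    ∃ Φ : EquivL2.invariantFunctions G S →ₙₐ[ℂ]
        (EquivL2.isotypical μ ρ α →L[ℂ] EquivL2.isotypical μ ρ α),
      (∀ f, ∀ s : EquivL2.isotypical μ ρ α, ∀ᵐ x ∂μ,
        EquivL2.L2.rep (Φ f s : EquivL2.L2 F V μ) x =
          EquivL2.extendZero (f : S →ᵇ ℂ) x • EquivL2.L2.rep (s : EquivL2.L2 F V μ) x) ∧
      (∀ f, ∀ s t : EquivL2.isotypical μ ρ α, inner ℂ (Φ f s) t = inner ℂ s (Φ (star f) t)) ∧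
      (∀ f, IsCompactOperator (Φ f) ↔ f = 0) ∧
      Function.Injective fun f =>
        Ideal.Quotient.mk (EquivL2.compactIdeal (EquivL2.isotypical μ ρ α)) (Φ f) := by
  have : IsTopologicalGroup G := topologicalGroup_of_lieGroup (𝓡 d) ∞
  have : ContinuousSMul G M := ContMDiffSMul.continuousSMul (I := 𝓡 d) (I' := 𝓡 n) (n := ∞)
  have : SecondCountableTopology M := inferInstance
  subst hμ
  have hqmp : ∀ g : G, Measure.QuasiMeasurePreserving (g • · : M → M)
      (Measure.euclideanHausdorffMeasure n) (Measure.euclideanHausdorffMeasure n) := fun g =>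
    ((IsometryEquiv.constSMul g).measurePreserving_euclideanHausdorffMeasure
      n).quasiMeasurePreserving
  have hslice : EquivL2.HasSmallSlices G M := EquivL2.hasSmallSlices d n
  have hPinv : ∀ (g : G), ∀ x ∈ EquivL2.discreteSlicePoints G d n M,
      g • x ∈ EquivL2.discreteSlicePoints G d n M := fun g _ =>
    EquivL2.smul_mem_discreteSlicePoints g
  have hmeas : MeasurableSet S := by
    rw [hS]
    exact (EquivL2.isClosed_discreteSlicePoints.measurableSet.union
      (EquivL2.isOpen_nullSet hslice).measurableSet).compl
  have hinv : ∀ (g : G), ∀ x ∈ S, g • x ∈ S := by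
    rw [hS]
    intro g x hx hgx
    refine hx (hgx.imp (fun h => ?_) fun h => ?_)
    · simpa using hPinv g⁻¹ _ h
    · simpa using EquivL2.smul_mem_nullSet hslice g⁻¹ h
  have hcompact : ∀ f, IsCompactOperator (EquivL2.mulHom (ρ := ρ) (α := α) hqmp hmeas hinv f) ↔
      f = 0 := fun f =>
    ⟨EquivL2.eq_zero_of_isCompactOperator_mulHom hqmp hslice
      EquivL2.isClosed_discreteSlicePoints hPinv
      (fun x hx => EquivL2.exists_seq_invariant_nhds_measure_iInter_eq_zero hx) hS hmeas hinv f,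
      fun h => by rw [h, map_zero]; exact isCompactOperator_zero⟩
  refine ⟨EquivL2.mulHom hqmp hmeas hinv, fun f s => EquivL2.L2.rep_mulOp _ _, fun f s t => ?_,
    hcompact, fun f g hfg => ?_⟩
  · refine EquivL2.inner_mulOp_left _ _ (fun x => ?_) _ _
    by_cases hx : x ∈ S <;> simp [EquivL2.extendZero, hx]
  · refine sub_eq_zero.1 ((hcompact (f - g)).1 ?_)
    rw [map_sub]
    exact Ideal.Quotient.eq.1 hfg
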